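/- Let $w\in S_n$, let $\ell$ denote Coxeter length (with respect to the adjacent transpositions), let $\preceq$ denote (strong) Bruhat order, and let $[e,w]=\{u\in S_n : u\preceq w\}$. For $u \in S_n$ put $\boldsymbol{u}=(u^{-1}(1),\ldots,u^{-1}(n))\in\mathbb{R}^n$, let $Q_w$ be the convex hull of $\{\boldsymbol{u} : u\preceq w\}$, and for $u\preceq w$ let $\deg_w(\boldsymbol{u})$ be the number of edges (one-dimensional faces) of the polytope $Q_w$ incident to the vertex $\boldsymbol{u}$. For $u,v\in[e,w]$ write $u\lessdot_w v$ if $Q_w$ has an edge between $\boldsymbol{u}$ and $\boldsymbol{v}$ and $\ell(u)<\ell(v)$, and let $\le_w$ be the reflexive transitive closure of $\lessdot_w$ on $[e,w]$. For $u\preceq w$ let $\tilde\Gamma_w(u)$ be the (acyclic) directed graph on $\{1,\ldots,n\}$ with edges $(u(i),u(j))$ for all $i<j$ such that $u(i\,j)\preceq w$ and $|\ell(u(i\,j))-\ell(u)|=1$, and let $E_w(u)$ be the edge set of its transitive reduction $\Gamma_w(u)$. Write $c\overset{u}{\Leftrightarrow}d$ if $(c,d)\in E_w(u)$ or $(d,c)\in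 E_w(u)$. (a) If $u\le_w v$, then $\deg_w(\boldsymbol{u})\le\deg_w(\boldsymbol{v})$. (b) If $u\lessdot_w v$, then $v=tu$ for a transposition $t$, and whenever $c\overset{u}{\Leftrightarrow}d$ there is a unique edge of $E_w(v)$ described by $c\overset{v}{\Leftrightarrow}d$ or $t(c)\overset{v}{\Leftrightarrow}t(d)$, that is, a unique edge in $E_w(v)$ whose set of endpoints is $\{c,d\}$ or $\{t(c),t(d)\}$. Moreover, the map $\varphi:E_w(u)\to E_w(v)$ sending each edge $c\overset{u}{\Leftrightarrow}d$ to the corresponding edge of $E_w(v)$ is injective. -/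

import Mathlib

/-! Permutations in `S_n` are `Equiv.Perm (Fin n)`, with `(u * v) i = u (v i)`; the element
`i : Fin n` stands for `i + 1` in `{1, …, n}`. -/

namespace BruhatPolytope

open Equiv

/-- The simple generators of `S_n`: the adjacent transpositions. -/
def IsSimple {n : ℕ} (s : Perm (Fin n)) : Prop :=
  ∃ i j : Fin n, (i : ℕ) + 1 = (j : ℕ) ∧ s = swap i j

/-- Coxeter length: the least number of factors in an expression of `w` as a product of
adjacent transpositions. -/
noncomputable def length {n : ℕ} (w : Perm (Fin n)) : ℕ :=
  sInf {k | ∃ l : List (Perm (Fin n)), (∀ s ∈ l, IsSimple s) ∧ l.prod = w ∧ l.length = k}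

/-- The covering relation of the (strong) Bruhat order: `y = x t` with `t` a transposition and
`ℓ(y) = ℓ(x) + 1`. -/
def BruhatCover {n : ℕ} (x y : Perm (Fin n)) : Prop :=
  ∃ t : Perm (Fin n), t.IsSwap ∧ y = x * t ∧ length y = length x + 1

/-- The (strong) Bruhat order on `S_n`. -/
def BruhatLE {n : ℕ} : Perm (Fin n) → Perm (Fin n) → Prop :=
  Relation.ReflTransGen BruhatCover

/-- The lower Bruhat interval `[e, w]`. -/
def Interval {n : ℕ} (w : Perm (Fin n)) : Type :=
  {u : Perm (Fin n) // BruhatLE u w}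

/-- The vector `(w⁻¹(1), …, w⁻¹(n))` attached to the permutation `w`. -/
def vec {n : ℕ} (w : Perm (Fin n)) : Fin n → ℝ :=
  fun i => ((w⁻¹ i : Fin n) : ℕ) + 1

/-- The Bruhat interval polytope `Q_w`. -/
def Q {n : ℕ} (w : Perm (Fin n)) : Set (Fin n → ℝ) :=
  convexHull ℝ {x | ∃ u : Perm (Fin n), BruhatLE u w ∧ x = vec u}

/-- `F` is an edge of the polytope `K`: a face (the locus in `K` where some linear functional is
maximal on `K`) of dimension one. -/
def IsEdge {n : ℕ} (K F : Set (Fin n → ℝ)) : Prop :=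
  IsExposed ℝ K F ∧ Module.finrank ℝ (vectorSpan ℝ F) = 1

/-- The number of edges of `Q_w` incident to the vertex attached to `u`. -/
noncomputable def deg {n : ℕ} (w u : Perm (Fin n)) : ℕ∞ :=
  Set.encard {F | IsEdge (Q w) F ∧ vec u ∈ F}

/-- The cover relation `u ⋖_w v` of the 1-skeleton poset `P_w`: the polytope `Q_w` has an edge
between the vertices attached to `u` and `v`, and `ℓ(u) < ℓ(v)`. -/
def SkeletonCover {n : ℕ} (w : Perm (Fin n)) (u v : Interval w) : Prop :=
  IsEdge (Q w) (segment ℝ (vec u.1) (vec v.1)) ∧ length u.1 < length v.1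

/-- The order relation `u ≤_w v` of the 1-skeleton poset `P_w` on `[e, w]`. -/
def SkeletonLE {n : ℕ} (w : Perm (Fin n)) : Interval w → Interval w → Prop :=
  Relation.ReflTransGen (SkeletonCover w)

/-- The edges of the directed graph `Γ̃_w(u)` on `{1, …, n}`: the pairs `(u(i), u(j))` with `i < j`,
`u (i j) ≼ w` and `|ℓ(u (i j)) - ℓ(u)| = 1`. -/
def TildeArc {n : ℕ} (w u : Perm (Fin n)) (a b : Fin n) : Prop :=
  ∃ i j : Fin n, i < j ∧ a = u i ∧ b = u j ∧ BruhatLE (u * swap i j) w ∧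
    |(length (u * swap i j) : ℤ) - (length u : ℤ)| = 1

/-- The edge set `E_w(u)` of the transitive reduction `Γ_w(u)` of `Γ̃_w(u)`. As `Γ̃_w(u)` is
acyclic, these are the edges `(a, b)` of `Γ̃_w(u)` for which no directed path from `a` to `b`
passes through an intermediate vertex. -/
def E {n : ℕ} (w u : Perm (Fin n)) : Set (Fin n × Fin n) :=
  {e | TildeArc w u e.1 e.2 ∧
    ¬ ∃ c : Fin n, Relation.TransGen (TildeArc w u) e.1 c ∧
      Relation.TransGen (TildeArc w u) c e.2}

/-- The edge `e` is described by `c ⇔ d`: it is `(c, d)` or `(d, c)`. -/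
def Joins {n : ℕ} (e : Fin n × Fin n) (c d : Fin n) : Prop :=
  e = (c, d) ∨ e = (d, c)

/-- The edge `e` is described by `c ⇔ d` or by `t(c) ⇔ t(d)`. -/
def Corresponds {n : ℕ} (t : Perm (Fin n)) (c d : Fin n) (e : Fin n × Fin n) : Prop :=
  Joins e c d ∨ Joins e (t c) (t d)

end BruhatPolytope

/-! The edges of Q_w at u are governed by the cone of functionals that are maximal at u. If a stands
before b in u, exchanging them changes the value of f by a positive multiple of f(a) - f(b). A
maximal f therefore satisfies f(a) ≤ f(b) on every arc, that is, for every such exchange that stays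
below w (`Arc`). These local inequalities also suffice (`sum_mul_vec_le`). Behind this is the
maximality property of Coxeter matroids: every translate x[e, w] has a Bruhat-greatest element
(`exists_greatest_translate`), and an element that is locally maximal is that greatest one
(`translate_le_of_local`).

So the cone at u consists of the order-preserving functions for the closure of `Arc`. The edges at u
correspond to its covering arcs, which form E_w(u) (`mem_E_iff`, `deg_eq_encard_E`).

Now let (a, b) be a covering arc at u with a < b, and v = (a b)u. A functional with f(a) = f(b)
takes equal values at u and v, so it is maximal at both or at neither. Hence the orders at u and v
agree once a and b are identified (`contract_of_arc`). A common contraction alone does not match the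
covers. What does is that inversions are always arcs, that an arc splits at any vertex intermediate
in both position and value (`ArcSystem`), and that a, b are inverted at v but not at u. Then each
cover at u survives at v, either as it is or with a and b exchanged (`ArcFlip.exists_cov`). A
covering pair and its image under (a b) cannot both be covers unless they coincide
(`ArcSystem.swap_eq_of_cov`), which gives uniqueness and injectivity. The degree inequality follows
by counting. -/

namespace BruhatPolytope

open Equiv Relation

variable {n : ℕ}

/-! ### Inversions and Coxeter length -/

/-- The inversions of a permutation, as pairs of positions. -/
def invSet (u : Perm (Fin n)) : Finset (Fin n × Fin n) :=
  Finset.univ.filter fun p => p.1 < p.2 ∧ u p.2 < u p.1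

/-- The number of inversions of a permutation. -/
def inv (u : Perm (Fin n)) : ℕ := (invSet u).card

theorem mem_invSet {u : Perm (Fin n)} {p : Fin n × Fin n} :
    p ∈ invSet u ↔ p.1 < p.2 ∧ u p.2 < u p.1 := by
  simp [invSet]

theorem inv_one : inv (1 : Perm (Fin n)) = 0 := by
  rw [inv, Finset.card_eq_zero, Finset.eq_empty_iff_forall_notMem]
  intro p hp
  rw [mem_invSet] at hp
  exact lt_asymm hp.1 hp.2

theorem swap_left_mul (u : Perm (Fin n)) (a b : Fin n) :
    swap a b * u = u * swap (u⁻¹ a) (u⁻¹ b) := by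
  rw [Equiv.mul_swap_eq_swap_mul]; simp

theorem mul_swap_eq (u : Perm (Fin n)) (i j : Fin n) :
    u * swap i j = swap (u i) (u j) * u := Equiv.mul_swap_eq_swap_mul u i j

/-- The map φ applies the swap to both entries of a pair of positions when this keeps their order,
and fixes the pair otherwise. It is an involution on the ordered pairs other than (i, j) and matches
inversions of u with inversions of `u * swap i j`; the pair (i, j) is the one new inversion. -/
theorem inv_mul_swap_of_cover {u : Perm (Fin n)} {i j : Fin n} (hij : i < j) (hu : u i < u j)
    (hb : ∀ k, i < k → k < j → u i < u k → ¬ u k < u j) :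
    inv (u * swap i j) = inv u + 1 := by
  classical
  have key : ∀ k, i < k → k < j → (u k < u i ∧ u k < u j ∨ u i < u k ∧ u j < u k) := by
    intro k h1 h2
    have h3 : u k ≠ u i := fun h => h1.ne' (u.injective h)
    have h4 : u k ≠ u j := fun h => h2.ne (u.injective h)
    have := hb k h1 h2
    omega
  have hmem : (i, j) ∈ invSet (u * swap i j) := by
    rw [mem_invSet]; simp [hij, hu]
  let φ : Fin n × Fin n → Fin n × Fin n := fun p =>
    if swap i j p.1 < swap i j p.2 then (swap i j p.1, swap i j p.2) else p
  have hφφ : ∀ p : Fin n × Fin n, p.1 < p.2 → φ (φ p) = p := by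
    rintro ⟨p, q⟩ h
    by_cases hs : swap i j p < swap i j q
    · have : φ (p, q) = (swap i j p, swap i j q) := if_pos hs
      rw [this]
      refine (if_pos (by simpa using h)).trans (by simp)
    · have : φ (p, q) = (p, q) := if_neg hs
      rw [this, this]
  have hφ : ∀ p : Fin n × Fin n, p.1 < p.2 → p ≠ (i, j) → (φ p).1 < (φ p).2 ∧ φ p ≠ (i, j) ∧
      (u p.2 < u p.1 ↔ (u * swap i j) (φ p).2 < (u * swap i j) (φ p).1) := by
    rintro ⟨p, q⟩ h hne
    by_cases hs : swap i j p < swap i j q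
    · have e : φ (p, q) = (swap i j p, swap i j q) := if_pos hs
      rw [e]
      refine ⟨hs, fun e' => ?_, by simp⟩
      rw [Prod.mk.injEq, swap_apply_eq_iff, swap_apply_eq_iff, swap_apply_left,
        swap_apply_right] at e'
      obtain ⟨rfl, rfl⟩ := e'
      exact lt_asymm h hij
    · have e : φ (p, q) = (p, q) := if_neg hs
      rw [e]
      refine ⟨h, hne, ?_⟩
      simp only [Perm.mul_apply]
      simp only at h
      by_cases hp : p = i
      · subst hp
        have hq1 : q ≠ p := h.ne'
        have hq2 : q ≠ j := fun e => hne (by rw [e])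
        rw [swap_apply_left, swap_apply_of_ne_of_ne hq1 hq2] at hs ⊢
        have := key q h (lt_of_le_of_ne (not_lt.1 hs) hq2)
        omega
      · by_cases hq : q = j
        · subst hq
          rw [swap_apply_right, swap_apply_of_ne_of_ne hp h.ne] at hs ⊢
          have := key p (lt_of_le_of_ne (not_lt.1 hs) (Ne.symm hp)) h
          omega
        · exfalso
          by_cases hp' : p = j
          · subst hp'
            have hq' : q ≠ i := (hij.trans h).ne'
            rw [swap_apply_right, swap_apply_of_ne_of_ne hq' hq] at hs
            exact hs (hij.trans h)
          · rw [swap_apply_of_ne_of_ne hp hp'] at hs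
            by_cases hq' : q = i
            · subst hq'
              rw [swap_apply_left] at hs
              exact hs (h.trans hij)
            · rw [swap_apply_of_ne_of_ne hq' hq] at hs
              exact hs h
  have h1 : (invSet u).card = ((invSet (u * swap i j)).erase (i, j)).card := by
    refine Finset.card_nbij' φ φ ?_ ?_ ?_ ?_
    · intro p hp
      have hp' := mem_invSet.1 hp
      have hne : p ≠ (i, j) := by rintro rfl; exact lt_asymm hu hp'.2
      obtain ⟨h1, h2, h3⟩ := hφ p hp'.1 hne
      exact Finset.mem_coe.2 (Finset.mem_erase.2 ⟨h2, mem_invSet.2 ⟨h1, h3.1 hp'.2⟩⟩)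
    · intro p hp
      obtain ⟨hne, hp⟩ := Finset.mem_erase.1 (Finset.mem_coe.1 hp)
      have hp' := mem_invSet.1 hp
      obtain ⟨h1, h2, -⟩ := hφ p hp'.1 hne
      obtain ⟨-, -, h3⟩ := hφ _ h1 h2
      rw [hφφ p hp'.1] at h3
      exact Finset.mem_coe.2 (mem_invSet.2 ⟨h1, h3.2 hp'.2⟩)
    · intro p hp
      exact hφφ p (mem_invSet.1 hp).1
    · intro p hp
      exact hφφ p (mem_invSet.1 (Finset.mem_of_mem_erase hp)).1
  rw [inv, inv, h1, Finset.card_erase_of_mem hmem]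
  have := Finset.card_pos.2 ⟨_, hmem⟩
  omega

theorem mul_swap_three {u : Perm (Fin n)} {i j k : Fin n} (hik : i ≠ k) (hkj : k ≠ j)
    (hij : i ≠ j) : u * swap i j = u * swap i k * swap k j * swap i k := by
  ext x
  simp only [Perm.mul_apply, swap_apply_def]
  grind

/-- Induction on j - i. An intermediate k factors (i j) as (i k)(k j)(i k), three exchanges over
shorter distances that each raise `inv`; without such k the increase is exactly 1. -/
theorem inv_lt_mul_swap_aux (m : ℕ) : ∀ (u : Perm (Fin n)) (i j : Fin n), (j : ℕ) - i ≤ m → i < j →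
    u i < u j → inv u < inv (u * swap i j) ∧
      ((∃ k, i < k ∧ k < j ∧ u i < u k ∧ u k < u j) → inv u + 1 < inv (u * swap i j)) := by
  induction m with
  | zero => intro u i j h hij; omega
  | succ m ih =>
    intro u i j hm hij hu
    have hbig : (∃ k, i < k ∧ k < j ∧ u i < u k ∧ u k < u j) →
        inv u + 1 < inv (u * swap i j) := by
      rintro ⟨k, h1, h2, h3, h4⟩
      rw [mul_swap_three h1.ne h2.ne hij.ne]
      have e1 := (ih u i k (by omega) h1 h3).1
      have e2 := (ih (u * swap i k) k j (by omega) h2 (by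
        simpa [swap_apply_of_ne_of_ne hij.ne' h2.ne'] using hu)).1
      have e3 := (ih (u * swap i k * swap k j) i k (by omega) h1 (by
        simpa [swap_apply_of_ne_of_ne hij.ne' h2.ne', swap_apply_of_ne_of_ne h1.ne hij.ne]
          using h4)).1
      omega
    refine ⟨?_, hbig⟩
    by_cases hk : ∃ k, i < k ∧ k < j ∧ u i < u k ∧ u k < u j
    · have := hbig hk; omega
    · rw [inv_mul_swap_of_cover hij hu fun k h1 h2 h3 h4 => hk ⟨k, h1, h2, h3, h4⟩]
      omega

theorem inv_lt_mul_swap {u : Perm (Fin n)} {i j : Fin n} (hij : i < j) (hu : u i < u j) :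
    inv u < inv (u * swap i j) :=
  (inv_lt_mul_swap_aux _ u i j le_rfl hij hu).1

theorem inv_mul_swap_eq_succ_iff {u : Perm (Fin n)} {i j : Fin n} (hij : i < j) (hu : u i < u j) :
    inv (u * swap i j) = inv u + 1 ↔ ¬ ∃ k, i < k ∧ k < j ∧ u i < u k ∧ u k < u j := by
  refine ⟨fun h hk => ?_, fun h => inv_mul_swap_of_cover hij hu
    fun k h1 h2 h3 h4 => h ⟨k, h1, h2, h3, h4⟩⟩
  have := (inv_lt_mul_swap_aux _ u i j le_rfl hij hu).2 hk
  omega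

/-- Exchanging consecutive values that occur in increasing order adds one inversion. -/
theorem inv_swap_mul {x : Perm (Fin n)} {k l : Fin n} (hkl : (k : ℕ) + 1 = l)
    (hx : x⁻¹ k < x⁻¹ l) : inv (swap k l * x) = inv x + 1 := by
  rw [swap_left_mul, inv_mul_swap_of_cover hx]
  · simp; omega
  · intro p _ _ h3 h4
    simp at h3 h4
    omega

theorem strictMono_of_succ {α : Type*} [Preorder α] {f : Fin n → α}
    (h : ∀ i j : Fin n, (i : ℕ) + 1 = j → f i < f j) : StrictMono f := by
  cases n with
  | zero => exact fun i => i.elim0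
  | succ n => exact Fin.strictMono_iff_lt_succ.2 fun i => h _ _ (by simp)

theorem eq_one_of_no_descent {x : Perm (Fin n)}
    (h : ∀ k l : Fin n, (k : ℕ) + 1 = l → x⁻¹ k < x⁻¹ l) : x = 1 := by
  have h1 : StrictMono (x⁻¹ : Perm (Fin n)) := strictMono_of_succ h
  have h2 : h1.orderIsoOfSurjective _ x⁻¹.surjective = OrderIso.refl _ := Subsingleton.elim _ _
  have : x⁻¹ = 1 := Equiv.ext fun i => congrArg (fun f : Fin n ≃o Fin n => f i) h2
  simpa using this

theorem swap_mul_swap_mul (k l : Fin n) (x : Perm (Fin n)) : swap k l * (swap k l * x) = x := by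
  rw [← mul_assoc, swap_mul_self, one_mul]

theorem inv_apply_lt_or {x : Perm (Fin n)} {k l : Fin n} (hkl : (k : ℕ) + 1 = l) :
    x⁻¹ k < x⁻¹ l ∨ (swap k l * x)⁻¹ k < (swap k l * x)⁻¹ l := by
  rcases lt_trichotomy (x⁻¹ k) (x⁻¹ l) with h | h | h
  · exact Or.inl h
  · have := x⁻¹.injective h; omega
  · right; simpa using h

theorem inv_prod_le (l : List (Perm (Fin n))) (hl : ∀ s ∈ l, IsSimple s) :
    inv l.prod ≤ l.length := by
  induction l with
  | nil => simp [inv_one]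
  | cons s l ih =>
    have := ih fun s hs => hl s (by simp [hs])
    obtain ⟨i, j, hij, rfl⟩ := hl s (by simp)
    rw [List.prod_cons, List.length_cons]
    rcases inv_apply_lt_or (x := l.prod) hij with h | h
    · rw [inv_swap_mul hij h]; omega
    · have := inv_swap_mul hij h
      rw [swap_mul_swap_mul] at this
      omega

theorem exists_word (m : ℕ) : ∀ x : Perm (Fin n), inv x = m →
    ∃ l : List (Perm (Fin n)), (∀ s ∈ l, IsSimple s) ∧ l.prod = x ∧ l.length = m := by
  induction m with
  | zero =>
    intro x hx
    refine ⟨[], by simp, ?_, rfl⟩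
    rw [eq_one_of_no_descent (x := x)]
    · rfl
    · intro k l hkl
      refine (inv_apply_lt_or hkl).resolve_right fun h => ?_
      have := inv_swap_mul hkl h
      rw [swap_mul_swap_mul] at this
      omega
  | succ m ih =>
    intro x hx
    by_cases h : ∀ k l : Fin n, (k : ℕ) + 1 = l → x⁻¹ k < x⁻¹ l
    · rw [eq_one_of_no_descent h, inv_one] at hx; omega
    · push Not at h
      obtain ⟨k, l, hkl, h⟩ := h
      have h' := (inv_apply_lt_or hkl).resolve_left (not_lt.2 h)
      have := inv_swap_mul hkl h'
      rw [swap_mul_swap_mul] at this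
      obtain ⟨L, h1, h2, h3⟩ := ih (swap k l * x) (by omega)
      refine ⟨swap k l :: L, ?_, ?_, by simp [h3]⟩
      · intro s hs
        rcases List.mem_cons.1 hs with rfl | hs
        · exact ⟨k, l, hkl, rfl⟩
        · exact h1 s hs
      · rw [List.prod_cons, h2, swap_mul_swap_mul]

theorem length_eq_inv (x : Perm (Fin n)) : length x = inv x := by
  refine le_antisymm (Nat.sInf_le (exists_word _ x rfl)) ?_
  refine le_csInf ⟨_, exists_word _ x rfl⟩ ?_
  rintro k ⟨l, hl, rfl, rfl⟩
  exact inv_prod_le l hl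

/-! ### Bruhat order -/

/-- One step up in the Bruhat graph. -/
def Step (x y : Perm (Fin n)) : Prop := ∃ i j, i < j ∧ x i < x j ∧ y = x * swap i j

theorem Step.inv_lt {x y : Perm (Fin n)} (h : Step x y) : inv x < inv y := by
  obtain ⟨i, j, hij, hx, rfl⟩ := h
  exact inv_lt_mul_swap hij hx

theorem BruhatCover.step {x y : Perm (Fin n)} (h : BruhatCover x y) : Step x y := by
  obtain ⟨t, ⟨i, j, hij, rfl⟩, rfl, hl⟩ := h
  rw [length_eq_inv, length_eq_inv] at hl
  wlog h : i < j generalizing i j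
  · rw [swap_comm] at hl ⊢
    exact this j i hij.symm hl (lt_of_le_of_ne (not_lt.1 h) hij.symm)
  refine ⟨i, j, h, ?_, rfl⟩
  by_contra hx
  have hx' : x j < x i := lt_of_le_of_ne (not_lt.1 hx) fun e => hij (x.injective e.symm)
  have := inv_lt_mul_swap (u := x * swap i j) h (by simpa using hx')
  rw [mul_assoc, swap_mul_self, mul_one] at this
  omega

theorem bruhatLE_mul_swap_aux (m : ℕ) : ∀ (u : Perm (Fin n)) (i j : Fin n), (j : ℕ) - i ≤ m →
    i < j → u i < u j → BruhatLE u (u * swap i j) := by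
  induction m with
  | zero => intro u i j h hij; omega
  | succ m ih =>
    intro u i j hm hij hu
    by_cases hk : ∃ k, i < k ∧ k < j ∧ u i < u k ∧ u k < u j
    · obtain ⟨k, h1, h2, h3, h4⟩ := hk
      rw [mul_swap_three h1.ne h2.ne hij.ne]
      have e1 := ih u i k (by omega) h1 h3
      have e2 := ih (u * swap i k) k j (by omega) h2 (by
        simpa [swap_apply_of_ne_of_ne hij.ne' h2.ne'] using hu)
      have e3 := ih (u * swap i k * swap k j) i k (by omega) h1 (by
        simpa [swap_apply_of_ne_of_ne hij.ne' h2.ne', swap_apply_of_ne_of_ne h1.ne hij.ne]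
          using h4)
      exact (e1.trans e2).trans e3
    · refine ReflTransGen.single ⟨_, ⟨i, j, hij.ne, rfl⟩, rfl, ?_⟩
      rw [length_eq_inv, length_eq_inv, inv_mul_swap_eq_succ_iff hij hu]
      exact hk

theorem Step.bruhatLE {x y : Perm (Fin n)} (h : Step x y) : BruhatLE x y := by
  obtain ⟨i, j, hij, hx, rfl⟩ := h
  exact bruhatLE_mul_swap_aux _ x i j le_rfl hij hx

/-- Left multiplication by a simple transposition need not preserve length differences, but it
preserves steps up to a collapse, so the lifting arguments run on chains of steps. -/
theorem bruhatLE_eq : (BruhatLE : Perm (Fin n) → Perm (Fin n) → Prop) = ReflTransGen Step := by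
  funext x y
  refine propext ⟨fun h => ReflTransGen.mono (fun _ _ h => BruhatCover.step h) _ _ h, fun h => ?_⟩
  induction h with
  | refl => exact ReflTransGen.refl
  | tail _ h ih => exact ReflTransGen.trans ih h.bruhatLE

theorem BruhatLE.eq_or_inv_lt {x y : Perm (Fin n)} (h : BruhatLE x y) : x = y ∨ inv x < inv y := by
  rw [bruhatLE_eq] at h
  induction h with
  | refl => exact Or.inl rfl
  | tail _ h ih => rcases ih with rfl | ih
                   · exact Or.inr h.inv_lt
                   · exact Or.inr (ih.trans h.inv_lt)

theorem BruhatLE.antisymm {x y : Perm (Fin n)} (h : BruhatLE x y) (h' : BruhatLE y x) : x = y := by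
  rcases h.eq_or_inv_lt with h | h
  · exact h
  · rcases h'.eq_or_inv_lt with h' | h'
    · exact h'.symm
    · omega

theorem bruhatLE_trans {x y z : Perm (Fin n)} (h : BruhatLE x y) (h' : BruhatLE y z) :
    BruhatLE x z := ReflTransGen.trans h h'

theorem step_swap_mul {x : Perm (Fin n)} {k l : Fin n} (hkl : k < l) (hx : x⁻¹ k < x⁻¹ l) :
    Step x (swap k l * x) :=
  ⟨x⁻¹ k, x⁻¹ l, hx, by simpa using hkl, swap_left_mul x k l⟩

/-- Left multiplication by a simple transposition and one step in the Bruhat graph. -/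
theorem Step.swap_mul {x y : Perm (Fin n)} (h : Step x y) {k l : Fin n} (hkl : (k : ℕ) + 1 = l) :
    swap k l * x = y ∨ Step (swap k l * x) (swap k l * y) := by
  obtain ⟨i, j, hij, hx, rfl⟩ := h
  by_cases hc : x i = k ∧ x j = l
  · left
    rw [mul_swap_eq, hc.1, hc.2]
  · right
    refine ⟨i, j, hij, ?_, (mul_assoc _ _ _).symm⟩
    simp only [Perm.mul_apply, swap_apply_def]
    split_ifs <;> grind

/-- Multiply a chain from z to y throughout by s. Either the image is a chain, or a step collapses
onto a vertex of the original chain, which is followed from there on. -/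
theorem BruhatLE.swap_mul_left {z y : Perm (Fin n)} (h : BruhatLE z y) {k l : Fin n}
    (hkl : (k : ℕ) + 1 = l) :
    BruhatLE (swap k l * z) y ∨ BruhatLE (swap k l * z) (swap k l * y) := by
  rw [bruhatLE_eq] at h ⊢
  induction h with
  | refl => exact Or.inr ReflTransGen.refl
  | tail _ h ih =>
    rcases ih with ih | ih
    · exact Or.inl (ih.tail h)
    · rcases h.swap_mul hkl with e | e
      · left; rwa [← e]
      · exact Or.inr (ih.tail e)

theorem BruhatLE.swap_mul_right {z y : Perm (Fin n)} (h : BruhatLE z y) {k l : Fin n}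
    (hkl : (k : ℕ) + 1 = l) :
    BruhatLE z (swap k l * y) ∨ BruhatLE (swap k l * z) (swap k l * y) := by
  rw [bruhatLE_eq] at h ⊢
  induction h using ReflTransGen.head_induction_on with
  | refl => exact Or.inr ReflTransGen.refl
  | head h _ ih =>
    rcases ih with ih | ih
    · exact Or.inl (ReflTransGen.head h ih)
    · rcases h.swap_mul hkl with e | e
      · left; rwa [← e, swap_mul_swap_mul] at ih
      · exact Or.inr (ReflTransGen.head e ih)

/-- If `y` has the descent, the lower interval of `y` is stable. -/
theorem BruhatLE.lift_of_descent {z y : Perm (Fin n)} (h : BruhatLE z y) {k l : Fin n}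
    (hkl : (k : ℕ) + 1 = l) (hy : y⁻¹ l < y⁻¹ k) : BruhatLE (swap k l * z) y := by
  rcases h.swap_mul_left hkl with h | h
  · exact h
  · refine bruhatLE_trans h ?_
    have := (step_swap_mul (x := swap k l * y) (k := k) (l := l) (by omega)
      (by simpa using hy)).bruhatLE
    rwa [swap_mul_swap_mul] at this

theorem BruhatLE.lift_of_ascent {z y : Perm (Fin n)} (h : BruhatLE z y) {k l : Fin n}
    (hkl : (k : ℕ) + 1 = l) (hy : y⁻¹ k < y⁻¹ l) : BruhatLE (swap k l * z) (swap k l * y) := by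
  rcases h.swap_mul_left hkl with h | h
  · exact bruhatLE_trans h (step_swap_mul (by omega) hy).bruhatLE
  · exact h

theorem BruhatLE.lift_down {z y : Perm (Fin n)} (h : BruhatLE z y) {k l : Fin n}
    (hkl : (k : ℕ) + 1 = l) (hz : z⁻¹ k < z⁻¹ l) : BruhatLE z (swap k l * y) := by
  rcases h.swap_mul_right hkl with h | h
  · exact h
  · exact bruhatLE_trans (step_swap_mul (by omega) hz).bruhatLE h

/-! ### The maximality property of lower Bruhat intervals -/

/-- The lower interval of `w`, translated by `x`, has a greatest element. -/
theorem exists_greatest_translate (m : ℕ) : ∀ x w : Perm (Fin n), inv x = m →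
    ∃ y, BruhatLE y w ∧ ∀ v, BruhatLE v w → BruhatLE (x * v) (x * y) := by
  induction m with
  | zero =>
    intro x w hx
    obtain ⟨L, -, rfl, hL⟩ := exists_word 0 x hx
    rw [List.length_eq_zero_iff] at hL
    subst hL
    exact ⟨w, ReflTransGen.refl, fun v hv => by simpa using hv⟩
  | succ m ih =>
    intro x w hx
    have hasc : ∃ k l : Fin n, (k : ℕ) + 1 = l ∧ x l < x k := by
      by_contra hcon
      push Not at hcon
      have h1 : x⁻¹ = 1 := eq_one_of_no_descent fun k l hkl => by
        rw [inv_inv]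
        exact lt_of_le_of_ne (hcon k l hkl) fun e => by
          have := x.injective e
          omega
      rw [inv_eq_one] at h1
      rw [h1, inv_one] at hx
      omega
    obtain ⟨k, l, hkl, hxkl⟩ := hasc
    set s := swap k l with hs
    have hss : s * s = 1 := swap_mul_self k l
    set x' := x * s with hx'
    have hxx' : ∀ z, x * (s * z) = x' * z := fun z => by rw [hx', mul_assoc]
    have hxx : ∀ z, x' * (s * z) = x * z := fun z => by
      rw [hx', mul_assoc, ← mul_assoc s s, hss, one_mul]
    have hx'k : x' k < x' l := by simpa [hx', hs] using hxkl
    have hinv : inv x' = m := by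
      have := inv_mul_swap_of_cover (u := x') (i := k) (j := l) (by omega) hx'k
        (by intro p h1 h2; omega)
      rw [← hs, hx', mul_assoc, hss, mul_one, ← hx'] at this
      omega
    rcases lt_trichotomy (w⁻¹ k) (w⁻¹ l) with hw | hw | hw
    · obtain ⟨y, hy, hmax⟩ := ih x' (s * w) hinv
      have hsw : (s * w)⁻¹ l < (s * w)⁻¹ k := by simpa [hs] using hw
      rcases lt_trichotomy (y⁻¹ k) (y⁻¹ l) with hyk | hyk | hyk
      -- If y ascended at k, l, then s y would still lie below s w, and x' (s y) would exceed the
      -- greatest element x' y.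
      · exfalso
        have h1 := hmax _ (hy.lift_of_descent hkl hsw)
        have h2 : Step (x' * y) (x' * (s * y)) := by
          refine ⟨y⁻¹ k, y⁻¹ l, hyk, by simpa using hx'k, ?_⟩
          rw [mul_assoc x' y, ← swap_left_mul]
        have h3 := h2.bruhatLE.antisymm h1
        exact h2.inv_lt.ne (congrArg inv h3)
      · have := y⁻¹.injective hyk; omega
      -- Here s y ascends at k, l, so s y ≤ s w can be lifted down to s y ≤ w.
      · refine ⟨s * y, ?_, fun v hv => ?_⟩
        · have h1 : BruhatLE (s * y) (s * w) := hy.lift_of_descent hkl hsw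
          have h2 := h1.lift_down hkl (by simpa [hs] using hyk)
          rwa [← hs, ← mul_assoc, hss, one_mul] at h2
        · rw [hxx', ← hxx]
          exact hmax _ (hv.lift_of_ascent hkl hw)
    · have := w⁻¹.injective hw; omega
    · obtain ⟨y, hy, hmax⟩ := ih x' w hinv
      refine ⟨s * y, hy.lift_of_descent hkl hw, fun v hv => ?_⟩
      rw [hxx', ← hxx]
      exact hmax _ (hv.lift_of_descent hkl hw)

/-- The arcs at `u` for all transpositions keeping `u` in the lower interval of `w`. -/
def Arc (w u : Perm (Fin n)) (a b : Fin n) : Prop :=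
  ∃ i j : Fin n, i < j ∧ a = u i ∧ b = u j ∧ BruhatLE (u * swap i j) w

/-- The interval below y is stable under every simple left multiplication, so a word for `z * y⁻¹`
can be applied letter by letter without leaving it. -/
theorem bruhatLE_top {y : Perm (Fin n)} (h : ∀ k l : Fin n, (k : ℕ) + 1 = l → y⁻¹ l < y⁻¹ k)
    (z : Perm (Fin n)) : BruhatLE z y := by
  obtain ⟨L, hL, hp, -⟩ := exists_word _ (z * y⁻¹) rfl
  have hz : z = L.prod * y := by rw [hp]; simp
  rw [hz]
  clear hp hz
  induction L with
  | nil => rw [List.prod_nil, one_mul]; exact ReflTransGen.refl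
  | cons s L ih =>
    obtain ⟨k, l, hkl, rfl⟩ := hL s (by simp)
    rw [List.prod_cons, mul_assoc]
    exact (ih fun s hs => hL s (by simp [hs])).lift_of_descent hkl (h k l hkl)

theorem inv_le_sq (u : Perm (Fin n)) : inv u ≤ n * n := by
  refine (Finset.card_le_univ _).trans ?_
  simp

/-- A permutation that is locally maximal for the order given by `x` is a greatest element. -/
theorem translate_le_of_local {w u : Perm (Fin n)} (hu : BruhatLE u w) (m : ℕ) :
    ∀ x : Perm (Fin n), n * n - inv (x * u) = m → (∀ a b, Arc w u a b → x b < x a) →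
      ∀ v, BruhatLE v w → BruhatLE (x * v) (x * u) := by
  induction m using Nat.strong_induction_on with
  | _ m ih =>
    intro x hm hloc v hv
    by_cases htop : ∀ k l : Fin n, (k : ℕ) + 1 = l → (x * u)⁻¹ l < (x * u)⁻¹ k
    · exact bruhatLE_top htop _
    push Not at htop
    obtain ⟨k, l, hkl, hle⟩ := htop
    have hlt : (x * u)⁻¹ k < (x * u)⁻¹ l := lt_of_le_of_ne hle fun e => by
      have := (x * u)⁻¹.injective e
      omega
    have hsinv := inv_swap_mul hkl hlt
    set s := swap k l with hs
    have hss : s * s = 1 := swap_mul_self k l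
    -- Left multiplication by s changes the order of the values k and l only, and in x u the value k
    -- stands before l, so no arc (a, b) has x(a) = l and x(b) = k.
    have hloc' : ∀ a b, Arc w u a b → (s * x) b < (s * x) a := by
      intro a b hab
      have h1 := hloc a b hab
      obtain ⟨i, j, hij, rfl, rfl, -⟩ := hab
      by_cases hc : x (u j) = k ∧ x (u i) = l
      · exfalso
        rw [← hc.1, ← hc.2] at hlt
        simp at hlt
        exact lt_asymm hlt hij
      · simp only [hs, Perm.mul_apply, swap_apply_def]
        split_ifs <;> grind
    have hbig := inv_le_sq (s * (x * u))
    have hIH := ih (n * n - inv (s * x * u)) (by rw [mul_assoc]; omega) (s * x) rfl hloc'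
    -- The greatest translate x y is squeezed between x u and s x u, whose lengths differ by 1. If
    -- it were s x u, then y would arise from u by an arc along which x increases, against `hloc`.
    obtain ⟨y, hy, hmax⟩ := exists_greatest_translate _ x w rfl
    have h1 : BruhatLE (x * u) (x * y) := hmax u hu
    have h2 : BruhatLE (x * y) (s * (x * u)) := by
      have := (hIH y hy).lift_of_descent hkl (by
        simpa [hs] using hlt)
      rwa [← hs, mul_assoc, ← mul_assoc s s, hss, one_mul, mul_assoc] at this
    have hxy : x * u = x * y ∨ x * y = s * (x * u) := by
      rcases h1.eq_or_inv_lt with h | h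
      · exact Or.inl h
      · rcases h2.eq_or_inv_lt with h' | h'
        · exact Or.inr h'
        · omega
    rcases hxy with h | h
    · rw [h]; exact hmax v hv
    · exfalso
      have hyu : y = u * swap ((x * u)⁻¹ k) ((x * u)⁻¹ l) := by
        rw [hs, swap_left_mul, mul_assoc] at h
        exact mul_left_cancel h
      have := hloc _ _ ⟨_, _, hlt, rfl, rfl, hyu ▸ hy⟩
      simp at this
      omega

/-! ### Linear functionals -/

theorem sum_mul_vec (f : Fin n → ℝ) (v : Perm (Fin n)) :
    ∑ k, f k * vec v k = ∑ p, f (v p) * ((p : ℕ) + 1 : ℝ) := by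
  rw [← Equiv.sum_comp v]
  simp [vec]

theorem Step.sum_le {g : Fin n → ℝ} (hg : Antitone g) {x y : Perm (Fin n)} (h : Step x y) :
    ∑ p, g (x p) * ((p : ℕ) + 1 : ℝ) ≤ ∑ p, g (y p) * ((p : ℕ) + 1 : ℝ) := by
  obtain ⟨i, j, hij, hx, rfl⟩ := h
  rw [← sub_nonneg, ← Finset.sum_sub_distrib]
  rw [Finset.sum_eq_add_of_mem i j (Finset.mem_univ _) (Finset.mem_univ _) hij.ne]
  · simp only [Perm.mul_apply, swap_apply_left, swap_apply_right]
    have h1 := hg hx.le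
    have h2 : ((i : ℕ) : ℝ) ≤ ((j : ℕ) : ℝ) := by exact_mod_cast hij.le
    nlinarith
  · rintro p - ⟨h1, h2⟩
    simp [swap_apply_of_ne_of_ne h1 h2]

theorem BruhatLE.sum_le {g : Fin n → ℝ} (hg : Antitone g) {x y : Perm (Fin n)}
    (h : BruhatLE x y) :
    ∑ p, g (x p) * ((p : ℕ) + 1 : ℝ) ≤ ∑ p, g (y p) * ((p : ℕ) + 1 : ℝ) := by
  rw [bruhatLE_eq] at h
  induction h with
  | refl => exact le_rfl
  | tail _ h ih => exact ih.trans (h.sum_le hg)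

/-- A functional which is monotone along the arcs at `u` is maximal at `u`. -/
theorem sum_mul_vec_le {w u : Perm (Fin n)} (hu : BruhatLE u w) {f : Fin n → ℝ}
    (hf : ∀ a b, Arc w u a b → f a ≤ f b) {v : Perm (Fin n)} (hv : BruhatLE v w) :
    ∑ k, f k * vec v k ≤ ∑ k, f k * vec u k := by
  -- `Tuple.sort` breaks ties by position, so x decreases strictly even along arcs on which f is
  -- constant. As x ranks the values by decreasing f, a translate that is larger in Bruhat order has
  -- a larger sum.
  obtain ⟨hmono, htie⟩ := Tuple.eq_sort_iff.1 (rfl : Tuple.sort (f ∘ u) = _)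
  set σ := Tuple.sort (f ∘ u)
  set x : Perm (Fin n) := Fin.revPerm * (u * σ)⁻¹ with hx
  have hfx : ∀ k, f (u (σ (Fin.rev (x k)))) = f k := by
    intro k; simp [hx]
  have hanti : Antitone fun q => f (u (σ (Fin.rev q))) := fun p q hpq =>
    hmono (Fin.rev_le_rev.2 hpq)
  have hloc : ∀ a b, Arc w u a b → x b < x a := by
    intro a b hab
    have h1 := hf a b hab
    obtain ⟨i, j, hij, rfl, rfl, -⟩ := hab
    suffices h : σ⁻¹ i < σ⁻¹ j by simpa [hx] using h
    by_contra hcon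
    have hne : σ⁻¹ j < σ⁻¹ i := lt_of_le_of_ne (not_lt.1 hcon) fun e =>
      hij.ne' (σ⁻¹.injective e)
    have h2 := hmono hne.le
    have h3 := htie _ _ hne (le_antisymm h2 (by simpa using h1))
    simp at h3
    exact lt_asymm h3 hij
  have hle := (translate_le_of_local hu _ x rfl hloc v hv).sum_le hanti
  rw [sum_mul_vec, sum_mul_vec]
  simpa only [Perm.mul_apply, hfx] using hle

/-! ### Arc systems -/

section ArcSystem

variable {α : Type*}

/-- `(a, b)` is an arc without intermediate vertices on directed paths. -/
def IsCov (r : α → α → Prop) (a b : α) : Prop :=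
  r a b ∧ ¬ ∃ c, TransGen r a c ∧ TransGen r c b

/-- The properties of the arcs at a permutation with respect to positions and values. -/
structure ArcSystem (pos val : α → ℤ) (r : α → α → Prop) : Prop where
  pos_inj : Function.Injective pos
  val_inj : Function.Injective val
  pos_lt : ∀ {a b}, r a b → pos a < pos b
  of_inversion : ∀ {a b}, pos a < pos b → val b < val a → r a b
  split : ∀ {p q z}, r p q → pos p < pos z → pos z < pos q → val p < val z → val z < val q →
    r p z ∧ r z q

theorem IsCov.flip {r : α → α → Prop} {a b : α} (h : IsCov r a b) :
    IsCov (Function.swap r) b a := by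
  refine ⟨h.1, fun ⟨c, h1, h2⟩ => h.2 ⟨c, ?_, ?_⟩⟩
  · rwa [transGen_swap] at h2
  · rwa [transGen_swap] at h1

theorem IsCov.of_flip {r : α → α → Prop} {a b : α} (h : IsCov (Function.swap r) a b) :
    IsCov r b a := h.flip

theorem isCov_of_transGen {r : α → α → Prop} {a b : α} (h : TransGen r a b)
    (h' : ∀ c, TransGen r a c → TransGen r c b → False) : IsCov r a b := by
  refine ⟨?_, fun ⟨c, h1, h2⟩ => h' c h1 h2⟩
  cases h with
  | single h => exact h
  | tail h1 h2 => exact (h' _ h1 (.single h2)).elim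

theorem IsCov.eq_or_eq {r : α → α → Prop} {a b x : α} (h : IsCov r a b) (h1 : ReflTransGen r a x)
    (h2 : ReflTransGen r x b) : x = a ∨ x = b := by
  rcases reflTransGen_iff_eq_or_transGen.1 h1 with h1 | h1
  · exact Or.inl h1
  rcases reflTransGen_iff_eq_or_transGen.1 h2 with h2 | h2
  · exact Or.inr h2.symm
  exact (h.2 ⟨x, h1, h2⟩).elim

namespace ArcSystem

variable {pos val : α → ℤ} {r : α → α → Prop}

/-- Statements about arcs entering a vertex follow by this symmetry from those about arcs leaving
it. -/
theorem dual (h : ArcSystem pos val r) :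
    ArcSystem (fun x => -pos x) (fun x => -val x) (Function.swap r) where
  pos_inj _ _ e := h.pos_inj (neg_injective e)
  val_inj _ _ e := h.val_inj (neg_injective e)
  pos_lt hab := neg_lt_neg (h.pos_lt hab)
  of_inversion h1 h2 := h.of_inversion (neg_lt_neg_iff.1 h1) (neg_lt_neg_iff.1 h2)
  split h1 h2 h3 h4 h5 := (h.split h1 (neg_lt_neg_iff.1 h3) (neg_lt_neg_iff.1 h2)
    (neg_lt_neg_iff.1 h5) (neg_lt_neg_iff.1 h4)).symm

theorem pos_lt_of_transGen (h : ArcSystem pos val r) {a b : α} (hab : TransGen r a b) :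
    pos a < pos b := by
  induction hab with
  | single h1 => exact h.pos_lt h1
  | tail _ h1 ih => exact ih.trans (h.pos_lt h1)

theorem pos_le (h : ArcSystem pos val r) {a b : α} (hab : ReflTransGen r a b) :
    pos a ≤ pos b := by
  rcases reflTransGen_iff_eq_or_transGen.1 hab with rfl | hab
  · exact le_rfl
  · exact (h.pos_lt_of_transGen hab).le

theorem transGen_of_ne {a b : α} (hab : ReflTransGen r a b) (hne : a ≠ b) :
    TransGen r a b :=
  (reflTransGen_iff_eq_or_transGen.1 hab).resolve_left (Ne.symm hne)

theorem arc_or_arc (h : ArcSystem pos val r) {x y z : α} (hxy : r x y)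
    (h1 : pos x < pos z) (h2 : pos z < pos y) : r x z ∨ r z y := by
  rcases lt_trichotomy (val z) (val x) with hz | hz | hz
  · exact Or.inl (h.of_inversion h1 hz)
  · rw [h.val_inj hz] at h1; omega
  rcases lt_trichotomy (val y) (val z) with hy | hy | hy
  · exact Or.inr (h.of_inversion h2 hy)
  · rw [h.val_inj hy] at h2; omega
  exact Or.inl (h.split hxy h1 h2 hz hy).1

/-- An element positioned between two comparable elements is comparable to one of them. -/
theorem interpolate (h : ArcSystem pos val r) {x y z : α} (hxy : TransGen r x y)
    (h1 : pos x < pos z) (h2 : pos z < pos y) : TransGen r x z ∨ TransGen r z y := by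
  induction hxy with
  | single hxy =>
    exact (h.arc_or_arc hxy h1 h2).imp TransGen.single TransGen.single
  | tail hxm hmy ih =>
    rename_i m y
    rcases lt_trichotomy (pos z) (pos m) with hz | hz | hz
    · exact (ih hz).imp id fun h3 => h3.tail hmy
    · rw [h.pos_inj hz]; exact Or.inl hxm
    · exact (h.arc_or_arc hmy hz h2).imp hxm.tail TransGen.single

/-! ### Elements comparable with only one end of a covering arc -/

section Cover

variable {a b : α}

/-- On a path from a past the position of b, some arc jumps over b, and b is joined to one of its
ends. The arc cannot be interrupted from its start to b, as (a, b) is a cover. If the jumping arc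
starts at a itself, val a < val b yields b → z by inversion or splitting. -/
theorem above_of_pos_lt (h : ArcSystem pos val r) (hab : IsCov r a b) (hval : val a < val b)
    {z : α} (haz : TransGen r a z) (hz : pos b < pos z) : TransGen r b z := by
  have hpab := h.pos_lt hab.1
  induction haz with
  | single haz =>
    rename_i z
    rcases lt_trichotomy (val z) (val b) with hv | hv | hv
    · exact .single (h.of_inversion hz hv)
    · rw [h.val_inj hv] at hz; omega
    · exact .single (h.split haz hpab hz hval hv).2
  | tail ham hmz ih =>
    rename_i m z
    rcases lt_trichotomy (pos b) (pos m) with hm | hm | hm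
    · exact (ih hm).tail hmz
    · rw [h.pos_inj hm]; exact .single hmz
    · rcases h.arc_or_arc hmz hm hz with h1 | h1
      · exact (hab.2 ⟨m, ham, .single h1⟩).elim
      · exact .single h1

/-- Any other location would put z above b, or on a path from a to b. -/
theorem above_inversion (h : ArcSystem pos val r) (hab : IsCov r a b) (hval : val a < val b)
    {z : α} (haz : TransGen r a z) (hbz : ¬ ReflTransGen r b z) :
    pos a < pos z ∧ pos z < pos b ∧ val z < val a := by
  have h0 := h.pos_lt_of_transGen haz
  have h1 : pos z < pos b := by
    rcases lt_trichotomy (pos b) (pos z) with hm | hm | hm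
    · exact (hbz (h.above_of_pos_lt hab hval haz hm).to_reflTransGen).elim
    · rw [h.pos_inj hm] at hbz; exact (hbz .refl).elim
    · exact hm
  refine ⟨h0, h1, ?_⟩
  by_contra hcon
  have h2 : val a < val z := lt_of_le_of_ne (not_lt.1 hcon) fun e => by
    rw [h.val_inj e] at h0; omega
  rcases lt_trichotomy (val z) (val b) with hv | hv | hv
  · obtain ⟨e1, e2⟩ := h.split hab.1 h0 h1 h2 hv
    exact hab.2 ⟨z, .single e1, .single e2⟩
  · rw [h.val_inj hv] at h1; omega
  · exact hab.2 ⟨z, haz, .single (h.of_inversion h1 hv)⟩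

theorem below_inversion (h : ArcSystem pos val r) (hab : IsCov r a b) (hval : val a < val b)
    {z : α} (hzb : TransGen r z b) (hza : ¬ ReflTransGen r z a) :
    pos a < pos z ∧ pos z < pos b ∧ val b < val z := by
  have := h.dual.above_inversion hab.flip (neg_lt_neg hval) (z := z)
    (by rwa [transGen_swap]) (by rwa [reflTransGen_swap])
  omega

end Cover

end ArcSystem

/-- The preorder obtained from the closure of `r` by identifying `a` and `b`. -/
def Contract (r : α → α → Prop) (a b x y : α) : Prop :=
  ReflTransGen r x y ∨ (ReflTransGen r x b ∧ ReflTransGen r a y)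

theorem Contract.trans {r : α → α → Prop} {a b x y z : α} (h1 : Contract r a b x y)
    (h2 : Contract r a b y z) : Contract r a b x z := by
  rcases h1 with h1 | ⟨h1, h1'⟩ <;> rcases h2 with h2 | ⟨h2, h2'⟩
  · exact Or.inl (h1.trans h2)
  · exact Or.inr ⟨h1.trans h2, h2'⟩
  · exact Or.inr ⟨h1, h1'.trans h2⟩
  · exact Or.inr ⟨h1, h2'⟩

theorem Contract.flip_iff {r : α → α → Prop} {a b x y : α} :
    Contract (Function.swap r) b a x y ↔ Contract r a b y x := by
  simp only [Contract, reflTransGen_swap, and_comm]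

theorem reflTransGen_of_contract {r : α → α → Prop} {a b z : α} (h1 : Contract r a b a z) :
    ReflTransGen r a z := by
  rcases h1 with h1 | ⟨-, h1⟩ <;> exact h1

/-- Two arc systems that differ by exchanging the positions of the ends of an arc `(a, b)` of the
first, and which agree after identifying `a` and `b`. -/
structure ArcFlip (pu pv val : α → ℤ) (ru rv : α → α → Prop) (a b : α) : Prop where
  left : ArcSystem pu val ru
  right : ArcSystem pv val rv
  pos_a : pv a = pu b
  pos_b : pv b = pu a
  pos_ne : ∀ x, x ≠ a → x ≠ b → pv x = pu x
  cov : IsCov ru a b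
  val_lt : val a < val b
  right_le : ∀ x y, rv x y → Contract ru a b x y
  left_le : ∀ x y, ru x y → Contract rv b a x y

/-! ### Transport of covering arcs across a flip -/

namespace ArcFlip

variable {pu pv val : α → ℤ} {ru rv : α → α → Prop} {a b : α}

theorem dual (h : ArcFlip pu pv val ru rv a b) :
    ArcFlip (fun x => -pu x) (fun x => -pv x) (fun x => -val x)
      (Function.swap ru) (Function.swap rv) b a where
  left := h.left.dual
  right := h.right.dual
  pos_a := congrArg Neg.neg h.pos_b
  pos_b := congrArg Neg.neg h.pos_a
  pos_ne x h1 h2 := congrArg Neg.neg (h.pos_ne x h2 h1)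
  cov := h.cov.flip
  val_lt := neg_lt_neg h.val_lt
  right_le x y hxy := Contract.flip_iff.2 (h.right_le y x hxy)
  left_le x y hxy := Contract.flip_iff.2 (h.left_le y x hxy)

theorem pos_lt (h : ArcFlip pu pv val ru rv a b) : pu a < pu b := h.left.pos_lt h.cov.1

theorem ne (h : ArcFlip pu pv val ru rv a b) : a ≠ b := by
  rintro rfl; exact lt_irrefl _ h.pos_lt

theorem right_arc (h : ArcFlip pu pv val ru rv a b) : rv b a :=
  h.right.of_inversion (by rw [h.pos_a, h.pos_b]; exact h.pos_lt) h.val_lt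

theorem contract_of_right (h : ArcFlip pu pv val ru rv a b) {x y : α}
    (hxy : ReflTransGen rv x y) : Contract ru a b x y := by
  induction hxy with
  | refl => exact Or.inl .refl
  | tail _ h1 ih => exact ih.trans (h.right_le _ _ h1)

theorem contract_of_left (h : ArcFlip pu pv val ru rv a b) {x y : α}
    (hxy : ReflTransGen ru x y) : Contract rv b a x y := by
  induction hxy with
  | refl => exact Or.inl .refl
  | tail _ h1 ih => exact ih.trans (h.left_le _ _ h1)

/-- Nothing lies strictly between the ends of a covering arc, so the contraction identifies only a
and b. -/
theorem contract_antisymm (h : ArcFlip pu pv val ru rv a b) {x y : α}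
    (h1 : Contract ru a b x y) (h2 : Contract ru a b y x) :
    x = y ∨ ((x = a ∨ x = b) ∧ (y = a ∨ y = b)) := by
  have key : ∀ {x y}, ReflTransGen ru a x → ReflTransGen ru x y → ReflTransGen ru y b →
      (x = a ∨ x = b) ∧ (y = a ∨ y = b) := fun h1 h2 h3 =>
    ⟨h.cov.eq_or_eq h1 (h2.trans h3), h.cov.eq_or_eq (h1.trans h2) h3⟩
  rcases h1 with h1 | ⟨h1, h1'⟩ <;> rcases h2 with h2 | ⟨h2, h2'⟩
  · left
    by_contra hne
    have := h.left.pos_lt_of_transGen (ArcSystem.transGen_of_ne h1 hne)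
    have := h.left.pos_le h2
    omega
  · exact Or.inr (key h2' h1 h2)
  · exact Or.inr (key h1' h2 h1).symm
  · exact Or.inr ⟨h.cov.eq_or_eq h2' h1, h.cov.eq_or_eq h1' h2⟩

theorem cov_right (h : ArcFlip pu pv val ru rv a b) : IsCov rv b a := by
  refine ⟨h.right_arc, fun ⟨c, h1, h2⟩ => ?_⟩
  have e1 := h.right.pos_lt_of_transGen h1
  have e2 := h.right.pos_lt_of_transGen h2
  have e3 : Contract ru a b c b :=
    (h.contract_of_right h2.to_reflTransGen).trans (Or.inl (.single h.cov.1))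
  rcases h.contract_antisymm (h.contract_of_right h1.to_reflTransGen) e3 with rfl | ⟨-, rfl | rfl⟩
  all_goals omega

/-- Arcs leaving the lower end of the exchanged arc. -/
theorem cov_of_cov_a (h : ArcFlip pu pv val ru rv a b) {d : α} (hd : d ≠ b)
    (had : IsCov ru a d) : IsCov rv a d ∨ IsCov rv b d := by
  have hda : d ≠ a := by rintro rfl; exact lt_irrefl _ (h.left.pos_lt had.1)
  have hmid : ∀ x, Contract ru a b a x → Contract ru a b x d → x = a ∨ x = b ∨ x = d := by
    intro x h1 h2
    have h1' := reflTransGen_of_contract h1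
    rcases h2 with h2 | ⟨h2, -⟩
    · rcases had.eq_or_eq h1' h2 with e | e <;> simp [e]
    · rcases h.cov.eq_or_eq h1' h2 with e | e <;> simp [e]
  have hbd : ReflTransGen rv b d := by
    rcases h.contract_of_left (.single had.1) with h1 | ⟨-, h1⟩
    · exact ReflTransGen.head h.right_arc h1
    · exact h1
  -- Whether a stays below d at v decides which of a and b inherits the arc.
  by_cases hadv : ReflTransGen rv a d
  · left
    refine isCov_of_transGen (ArcSystem.transGen_of_ne hadv hda.symm) fun x h1 h2 => ?_
    have e1 := h.right.pos_lt_of_transGen h1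
    have e2 := h.right.pos_lt_of_transGen h2
    have := h.pos_a
    have := h.pos_b
    have := h.pos_lt
    rcases hmid x (h.contract_of_right h1.to_reflTransGen)
      (h.contract_of_right h2.to_reflTransGen) with rfl | rfl | rfl <;> omega
  · right
    refine isCov_of_transGen (ArcSystem.transGen_of_ne hbd hd.symm) fun x h1 h2 => ?_
    have e1 := h.right.pos_lt_of_transGen h1
    have e2 := h.right.pos_lt_of_transGen h2
    have e3 : Contract ru a b a x :=
      Contract.trans (Or.inl (.single h.cov.1)) (h.contract_of_right h1.to_reflTransGen)
    rcases hmid x e3 (h.contract_of_right h2.to_reflTransGen) with rfl | rfl | rfl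
    · exact hadv h2.to_reflTransGen
    · omega
    · omega

/-- Arcs leaving the upper end of the exchanged arc. -/
theorem cov_of_cov_b (h : ArcFlip pu pv val ru rv a b) {d : α}
    (hbd : IsCov ru b d) : IsCov rv a d ∨ IsCov rv b d := by
  have hpd := h.left.pos_lt hbd.1
  have hpab := h.pos_lt
  have hpa := h.pos_a
  have hpb := h.pos_b
  have hdb : d ≠ b := by rintro rfl; omega
  have hda : d ≠ a := by rintro rfl; omega
  have hpvd := h.pos_ne d hda hdb
  have hvbd : ReflTransGen rv b d := by
    rcases h.contract_of_left (.single hbd.1) with h1 | ⟨-, h1⟩ <;> exact h1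
  have hright : ∀ x, x ≠ a → x ≠ b → pu b < pu x → Contract ru a b a x → Contract ru a b x d →
      x = d := by
    intro x hxa hxb hx h1 h2
    have h1' := ArcSystem.transGen_of_ne (reflTransGen_of_contract h1) (Ne.symm hxa)
    have h3 := h.left.above_of_pos_lt h.cov h.val_lt h1' hx
    rcases h2 with h2 | ⟨h2, -⟩
    · exact (hbd.eq_or_eq h3.to_reflTransGen h2).resolve_left hxb
    · have := h.left.pos_le h2; omega
  by_cases hadv : ReflTransGen rv a d
  · left
    refine isCov_of_transGen (ArcSystem.transGen_of_ne hadv hda.symm) fun x h1 h2 => ?_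
    have e1 := h.right.pos_lt_of_transGen h1
    have e2 := h.right.pos_lt_of_transGen h2
    have hxa : x ≠ a := by rintro rfl; omega
    have hxb : x ≠ b := by rintro rfl; omega
    have hxp := h.pos_ne x hxa hxb
    have := hright x hxa hxb (by omega) (h.contract_of_right h1.to_reflTransGen)
      (h.contract_of_right h2.to_reflTransGen)
    subst this
    omega
  · right
    refine isCov_of_transGen (ArcSystem.transGen_of_ne hvbd hdb.symm) fun x h1 h2 => ?_
    have e1 := h.right.pos_lt_of_transGen h1
    have e2 := h.right.pos_lt_of_transGen h2
    have hxa : x ≠ a := by rintro rfl; exact hadv h2.to_reflTransGen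
    have hxb : x ≠ b := by rintro rfl; omega
    have hxp := h.pos_ne x hxa hxb
    have c1 := h.contract_of_right h1.to_reflTransGen
    have c2 := h.contract_of_right h2.to_reflTransGen
    rcases lt_trichotomy (pu b) (pu x) with hx | hx | hx
    · have := hright x hxa hxb hx (Contract.trans (Or.inl (.single h.cov.1)) c1) c2
      subst this
      omega
    · exact hxb (h.left.pos_inj hx).symm
    -- At v the value a occupies the position `pu b`, strictly between those of x and d, so a is
    -- above x or below d.
    · rcases h.right.interpolate h2 (z := a) (by omega) (by omega) with h3 | h3
      · have c3 : Contract ru a b x b := (h.contract_of_right h3.to_reflTransGen).trans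
          (Or.inl (.single h.cov.1))
        rcases h.contract_antisymm c1 c3 with e | ⟨-, e | e⟩
        · exact hxb e.symm
        · exact hxa e
        · exact hxb e
      · exact hadv h3.to_reflTransGen

/-- Arcs disjoint from the exchanged arc. -/
theorem cov_of_cov_ne (h : ArcFlip pu pv val ru rv a b) {c d : α} (hca : c ≠ a) (hcb : c ≠ b)
    (hda : d ≠ a) (hdb : d ≠ b) (hcd : IsCov ru c d) : IsCov rv c d := by
  have hpcd := h.left.pos_lt hcd.1
  have hpab := h.pos_lt
  have hpa := h.pos_a
  have hpb := h.pos_b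
  have hpc := h.pos_ne c hca hcb
  have hpd := h.pos_ne d hda hdb
  -- Passing from c to b and then from a to d is the only way in which identifying a with b can
  -- affect the comparison of c and d.
  by_cases hbad : ReflTransGen ru c b ∧ ReflTransGen ru a d
  · obtain ⟨hc, hd⟩ := hbad
    have hc' : ¬ ReflTransGen ru c a := fun h1 => by
      rcases hcd.eq_or_eq h1 hd with e | e
      · exact hca e.symm
      · exact hda e.symm
    have hd' : ¬ ReflTransGen ru b d := fun h1 => by
      rcases hcd.eq_or_eq hc h1 with e | e
      · exact hcb e.symm
      · exact hdb e.symm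
    obtain ⟨c1, c2, c3⟩ := h.left.below_inversion h.cov h.val_lt
      (ArcSystem.transGen_of_ne hc hcb) hc'
    obtain ⟨d1, d2, d3⟩ := h.left.above_inversion h.cov h.val_lt
      (ArcSystem.transGen_of_ne hd hda.symm) hd'
    -- Now val d < val a < val b < val c, with c and d positioned between a and b, so (c, d) is an
    -- inversion at v as well. Any z positioned between c and d forms an inversion with c or with d.
    have hval := h.val_lt
    refine ⟨h.right.of_inversion (by omega) (by omega), fun ⟨z, h1, h2⟩ => ?_⟩
    have e1 := h.right.pos_lt_of_transGen h1
    have e2 := h.right.pos_lt_of_transGen h2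
    have hza : z ≠ a := by rintro rfl; omega
    have hzb : z ≠ b := by rintro rfl; omega
    have hpz := h.pos_ne z hza hzb
    have hmid : ¬ (ReflTransGen ru a z ∧ ReflTransGen ru z b) := fun hz =>
      (h.cov.eq_or_eq hz.1 hz.2).elim hza hzb
    have hmid' : ¬ (ReflTransGen ru c z ∧ ReflTransGen ru z d) := fun hz => by
      rcases hcd.eq_or_eq hz.1 hz.2 with rfl | rfl <;> omega
    rcases lt_trichotomy (val z) (val c) with hz | hz | hz
    · have hcz : ReflTransGen ru c z := .single (h.left.of_inversion (by omega) hz)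
      rcases h.contract_of_right h2.to_reflTransGen with h3 | ⟨h3, -⟩
      · exact hmid' ⟨hcz, h3⟩
      · refine hmid ⟨.single (h.left.of_inversion (by omega) ?_), h3⟩
        by_contra hcon
        exact hmid' ⟨hcz, .single (h.left.of_inversion (by omega) (by omega))⟩
    · rw [h.left.val_inj hz] at e1; omega
    · have hzd : ReflTransGen ru z d := .single (h.left.of_inversion (by omega) (by omega))
      rcases h.contract_of_right h1.to_reflTransGen with h3 | ⟨-, h3⟩
      · exact hmid' ⟨h3, hzd⟩
      · exact hmid ⟨h3, .single (h.left.of_inversion (by omega) (by omega))⟩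
  · have hav : ¬ (Contract ru a b c b ∧ Contract ru a b a d) := by
      rintro ⟨h1 | ⟨h1, -⟩, h2⟩ <;> exact hbad ⟨h1, reflTransGen_of_contract h2⟩
    have hab : Contract ru a b a b := Or.inl (.single h.cov.1)
    have hcdv : ReflTransGen rv c d := by
      rcases h.contract_of_left (.single hcd.1) with h1 | ⟨h1, h2⟩
      · exact h1
      · exact (hav ⟨(h.contract_of_right h1).trans hab,
          hab.trans (h.contract_of_right h2)⟩).elim
    refine isCov_of_transGen (ArcSystem.transGen_of_ne hcdv (by rintro rfl; omega))
      fun z h1 h2 => ?_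
    have e1 := h.right.pos_lt_of_transGen h1
    have e2 := h.right.pos_lt_of_transGen h2
    have c1 := h.contract_of_right h1.to_reflTransGen
    have c2 := h.contract_of_right h2.to_reflTransGen
    have hza : z ≠ a := by rintro rfl; exact hav ⟨c1.trans hab, c2⟩
    have hzb : z ≠ b := by rintro rfl; exact hav ⟨c1, hab.trans c2⟩
    rcases c1 with c1 | ⟨c1, c1'⟩ <;> rcases c2 with c2 | ⟨c2, c2'⟩
    · rcases hcd.eq_or_eq c1 c2 with rfl | rfl <;> omega
    · exact hbad ⟨c1.trans c2, c2'⟩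
    · exact hbad ⟨c1, c1'.trans c2⟩
    · exact hbad ⟨c1, c2'⟩

variable [DecidableEq α]

/-- Every arc of the first system gives an arc of the second, up to exchanging `a` and `b`. -/
theorem exists_cov (h : ArcFlip pu pv val ru rv a b) {c d : α} (hcd : IsCov ru c d) :
    IsCov rv c d ∨ IsCov rv (swap a b c) (swap a b d) := by
  have hpcd := h.left.pos_lt hcd.1
  have hpab := h.pos_lt
  by_cases hca : c = a
  · subst hca
    by_cases hdb : d = b
    · subst hdb; right; simpa using h.cov_right
    · have hda : d ≠ c := by rintro rfl; omega
      rw [swap_apply_left, swap_apply_of_ne_of_ne hda hdb]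
      exact h.cov_of_cov_a hdb hcd
  by_cases hcb : c = b
  · subst hcb
    have hdb : d ≠ c := by rintro rfl; omega
    have hda : d ≠ a := by rintro rfl; omega
    rw [swap_apply_right, swap_apply_of_ne_of_ne hda hdb]
    exact (h.cov_of_cov_b hcd).symm
  rw [swap_apply_of_ne_of_ne hca hcb]
  by_cases hdb : d = b
  · subst hdb
    rw [swap_apply_right]
    exact (h.dual.cov_of_cov_a hca hcd.flip).imp IsCov.of_flip IsCov.of_flip
  by_cases hda : d = a
  · subst hda
    rw [swap_apply_left]
    exact (h.dual.cov_of_cov_b hcd.flip).symm.imp IsCov.of_flip IsCov.of_flip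
  exact Or.inl (h.cov_of_cov_ne hca hcb hda hdb hcd)

/-- The orientation of the corresponding arc. -/
theorem not_cov_reverse (h : ArcFlip pu pv val ru rv a b) {c d : α} (hcd : IsCov ru c d) :
    ¬ ((c ≠ a ∨ d ≠ b) ∧ IsCov rv d c) ∧ ¬ IsCov rv (swap a b d) (swap a b c) := by
  have hpcd := h.left.pos_lt hcd.1
  have hpab := h.pos_lt
  have hab : Contract ru a b a b := Or.inl (.single h.cov.1)
  have hba : Contract ru a b b a := Or.inr ⟨.refl, .refl⟩
  have hs : ∀ x, Contract ru a b x (swap a b x) ∧ Contract ru a b (swap a b x) x := by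
    intro x
    by_cases hxa : x = a
    · subst hxa; rw [swap_apply_left]; exact ⟨hab, hba⟩
    by_cases hxb : x = b
    · subst hxb; rw [swap_apply_right]; exact ⟨hba, hab⟩
    rw [swap_apply_of_ne_of_ne hxa hxb]
    exact ⟨Or.inl .refl, Or.inl .refl⟩
  -- The comparison c ≤ d persists in the contraction, so d ≤ c forces c and d to be identified.
  have key : Contract ru a b d c → c = a ∧ d = b := by
    intro h1
    rcases h.contract_antisymm (Or.inl (.single hcd.1)) h1 with rfl | ⟨rfl | rfl, rfl | rfl⟩
    all_goals first | omega | exact ⟨rfl, rfl⟩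
  constructor
  · rintro ⟨hne, h1⟩
    have := key (h.contract_of_right (.single h1.1))
    tauto
  · intro h1
    obtain ⟨rfl, rfl⟩ := key ((hs d).1.trans ((h.contract_of_right (.single h1.1)).trans (hs c).2))
    rw [swap_apply_left, swap_apply_right] at h1
    have := h.right.pos_lt h1.1
    rw [h.pos_a, h.pos_b] at this
    omega

end ArcFlip

/-- Exchanging the ends of an arc of the transitive reduction moves no other arc to an arc. -/
theorem ArcSystem.swap_eq_of_cov [DecidableEq α] {pos val : α → ℤ} {r : α → α → Prop}
    (h : ArcSystem pos val r) {a b c d : α} (hab : IsCov r a b) (hcd : IsCov r c d)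
    (hcd' : IsCov r (swap a b c) (swap a b d)) : (swap a b c, swap a b d) = (c, d) := by
  have p1 := h.pos_lt hab.1
  have p2 := h.pos_lt hcd.1
  have p3 := h.pos_lt hcd'.1
  -- If exactly one of c, d is a or b, then (a, b) and one of the two other arcs compose to a path
  -- that refines the remaining one.
  by_cases hca : c = a
  · subst hca
    rw [swap_apply_left] at *
    by_cases hdb : d = b
    · subst hdb; rw [swap_apply_right] at *; omega
    · have hdc : d ≠ c := by rintro rfl; omega
      rw [swap_apply_of_ne_of_ne hdc hdb] at *
      exact (hcd.2 ⟨b, .single hab.1, .single hcd'.1⟩).elim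
  by_cases hcb : c = b
  · subst hcb
    have hdb : d ≠ c := by rintro rfl; omega
    have hda : d ≠ a := by rintro rfl; omega
    rw [swap_apply_right, swap_apply_of_ne_of_ne hda hdb] at *
    exact (hcd'.2 ⟨c, .single hab.1, .single hcd.1⟩).elim
  rw [swap_apply_of_ne_of_ne hca hcb] at *
  by_cases hda : d = a
  · subst hda
    rw [swap_apply_left] at *
    exact (hcd'.2 ⟨d, .single hcd.1, .single hab.1⟩).elim
  by_cases hdb : d = b
  · subst hdb
    rw [swap_apply_right] at *
    exact (hcd.2 ⟨a, .single hcd'.1, .single hab.1⟩).elim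
  rw [swap_apply_of_ne_of_ne hda hdb]

end ArcSystem

/-! ### The arcs at a permutation -/

/-- The position of a value, as an integer. -/
def posZ (u : Perm (Fin n)) (x : Fin n) : ℤ := ((u⁻¹ x : Fin n) : ℕ)

/-- A value, as an integer. -/
def valZ (x : Fin n) : ℤ := (x : ℕ)

theorem posZ_lt {u : Perm (Fin n)} {x y : Fin n} : posZ u x < posZ u y ↔ u⁻¹ x < u⁻¹ y := by
  simp [posZ]

theorem valZ_lt {x y : Fin n} : valZ x < valZ y ↔ x < y := by
  simp [valZ]

theorem bruhatLE_mul_swap_of_lt {u : Perm (Fin n)} {i j : Fin n} (hij : i < j) (h : u j < u i) :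
    BruhatLE (u * swap i j) u := by
  have : Step (u * swap i j) u :=
    ⟨i, j, hij, by simpa using h, by rw [mul_assoc, swap_mul_self, mul_one]⟩
  exact this.bruhatLE

/-- In (i j) = (i k)(k j)(i k) the last two factors go up. This and its mirror image provide the
`split` axiom. -/
theorem bruhatLE_mul_swap_left {u : Perm (Fin n)} {i j k : Fin n} (hik : i < k) (hkj : k < j)
    (h1 : u i < u k) (h2 : u k < u j) : BruhatLE (u * swap i k) (u * swap i j) := by
  have hij := hik.trans hkj
  rw [mul_swap_three hik.ne hkj.ne hij.ne]
  have e2 : Step (u * swap i k) (u * swap i k * swap k j) := ⟨k, j, hkj, by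
    simpa [swap_apply_of_ne_of_ne hij.ne' hkj.ne'] using h1.trans h2, rfl⟩
  have e3 : Step (u * swap i k * swap k j) (u * swap i k * swap k j * swap i k) :=
    ⟨i, k, hik, by simpa [swap_apply_of_ne_of_ne hij.ne' hkj.ne',
      swap_apply_of_ne_of_ne hik.ne hij.ne] using h2, rfl⟩
  exact bruhatLE_trans e2.bruhatLE e3.bruhatLE

theorem bruhatLE_mul_swap_right {u : Perm (Fin n)} {i j k : Fin n} (hik : i < k) (hkj : k < j)
    (h1 : u i < u k) (h2 : u k < u j) : BruhatLE (u * swap k j) (u * swap i j) := by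
  have hij := hik.trans hkj
  rw [swap_comm i j, swap_comm k j, mul_swap_three hkj.ne' hik.ne' hij.ne']
  have e2 : Step (u * swap j k) (u * swap j k * swap k i) := ⟨i, k, hik, by
    simpa [swap_apply_of_ne_of_ne hij.ne hik.ne] using h1.trans h2, by rw [swap_comm k i]⟩
  have e3 : Step (u * swap j k * swap k i) (u * swap j k * swap k i * swap j k) :=
    ⟨k, j, hkj, by simpa [swap_apply_of_ne_of_ne hij.ne hik.ne,
      swap_apply_of_ne_of_ne hkj.ne' hij.ne'] using h1, by rw [swap_comm k j]⟩
  exact bruhatLE_trans e2.bruhatLE e3.bruhatLE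

theorem arcSystem {w u : Perm (Fin n)} (hu : BruhatLE u w) :
    ArcSystem (posZ u) valZ (Arc w u) where
  pos_inj x y h := u⁻¹.injective (Fin.ext (by simpa [posZ] using h))
  val_inj x y h := Fin.ext (by simpa [valZ] using h)
  pos_lt := by
    rintro a b ⟨i, j, hij, rfl, rfl, -⟩
    simpa [posZ_lt] using hij
  of_inversion := by
    intro a b h1 h2
    rw [posZ_lt] at h1
    rw [valZ_lt] at h2
    exact ⟨u⁻¹ a, u⁻¹ b, h1, by simp, by simp,
      bruhatLE_trans (bruhatLE_mul_swap_of_lt h1 (by simpa using h2)) hu⟩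
  split := by
    rintro p q z ⟨i, j, hij, rfl, rfl, hw⟩ h1 h2 h3 h4
    obtain ⟨k, rfl⟩ := u.surjective z
    simp only [posZ_lt, valZ_lt, Perm.inv_def, symm_apply_apply] at h1 h2 h3 h4
    exact ⟨⟨i, k, h1, rfl, rfl, bruhatLE_trans (bruhatLE_mul_swap_left h1 h2 h3 h4) hw⟩,
      ⟨k, j, h2, rfl, rfl, bruhatLE_trans (bruhatLE_mul_swap_right h1 h2 h3 h4) hw⟩⟩

theorem TildeArc.arc {w u : Perm (Fin n)} {a b : Fin n} (h : TildeArc w u a b) : Arc w u a b := by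
  obtain ⟨i, j, hij, ha, hb, hw, -⟩ := h
  exact ⟨i, j, hij, ha, hb, hw⟩

/-- If the length change is not 1, some position between i and j carries a value between u i and u
j, and the arc factors through that value. Hence `TildeArc` and `Arc` have the same closure and the
same covers. -/
theorem Arc.tildeArc_or {w u : Perm (Fin n)} (hu : BruhatLE u w) {a b : Fin n}
    (h : Arc w u a b) : TildeArc w u a b ∨ ∃ c, Arc w u a c ∧ Arc w u c b := by
  have hs := arcSystem hu
  have harc := h
  obtain ⟨i, j, hij, rfl, rfl, hw⟩ := h
  by_cases hl : |(length (u * swap i j) : ℤ) - (length u : ℤ)| = 1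
  · exact Or.inl ⟨i, j, hij, rfl, rfl, hw, hl⟩
  right
  rw [length_eq_inv, length_eq_inv] at hl
  rcases lt_trichotomy (u i) (u j) with h | h | h
  · have : ¬ inv (u * swap i j) = inv u + 1 := fun e => hl (by rw [e]; simp)
    rw [inv_mul_swap_eq_succ_iff hij h, not_not] at this
    obtain ⟨k, h1, h2, h3, h4⟩ := this
    exact ⟨u k, hs.split harc (by simpa [posZ_lt] using h1) (by simpa [posZ_lt] using h2)
      (valZ_lt.2 h3) (valZ_lt.2 h4)⟩
  · exact absurd (u.injective h) hij.ne
  · have hy : (u * swap i j) i < (u * swap i j) j := by simpa using h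
    have hyy : u * swap i j * swap i j = u := by rw [mul_assoc, swap_mul_self, mul_one]
    have : ¬ inv (u * swap i j * swap i j) = inv (u * swap i j) + 1 := fun e => hl (by
      rw [hyy] at e
      rw [e]; simp)
    rw [inv_mul_swap_eq_succ_iff hij hy, not_not] at this
    obtain ⟨k, h1, h2, h3, h4⟩ := this
    simp only [Perm.mul_apply, swap_apply_left, swap_apply_right,
      swap_apply_of_ne_of_ne h1.ne' h2.ne] at h3 h4
    exact ⟨u k, hs.of_inversion (by simpa [posZ_lt] using h1) (valZ_lt.2 h4),
      hs.of_inversion (by simpa [posZ_lt] using h2) (valZ_lt.2 h3)⟩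

theorem Arc.transGen_tildeArc {w u : Perm (Fin n)} (hu : BruhatLE u w) (m : ℕ) :
    ∀ a b : Fin n, (posZ u b - posZ u a).toNat ≤ m → Arc w u a b →
      TransGen (TildeArc w u) a b := by
  have hs := arcSystem hu
  induction m with
  | zero => intro a b h hab; have := hs.pos_lt hab; omega
  | succ m ih =>
    intro a b h hab
    rcases hab.tildeArc_or hu with h1 | ⟨c, h1, h2⟩
    · exact .single h1
    · have e1 := hs.pos_lt h1
      have e2 := hs.pos_lt h2
      exact (ih a c (by omega) h1).trans (ih c b (by omega) h2)

theorem transGen_tildeArc_iff {w u : Perm (Fin n)} (hu : BruhatLE u w) {a b : Fin n} :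
    TransGen (TildeArc w u) a b ↔ TransGen (Arc w u) a b := by
  constructor
  · exact fun h => TransGen.mono (fun _ _ h => TildeArc.arc h) _ _ h
  · intro h
    induction h with
    | single h => exact h.transGen_tildeArc hu _ _ _ le_rfl
    | tail _ h ih => exact ih.trans (h.transGen_tildeArc hu _ _ _ le_rfl)

theorem mem_E_iff {w u : Perm (Fin n)} (hu : BruhatLE u w) {e : Fin n × Fin n} :
    e ∈ E w u ↔ IsCov (Arc w u) e.1 e.2 := by
  simp only [E, Set.mem_ofPred_eq, transGen_tildeArc_iff hu, IsCov]
  refine ⟨fun h => ⟨h.1.arc, h.2⟩, fun h => ⟨?_, h.2⟩⟩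
  refine (h.1.tildeArc_or hu).resolve_right fun ⟨c, h1, h2⟩ => h.2 ⟨c, .single h1, .single h2⟩

/-! ### Exchanging the ends of an arc -/

theorem vec_mul_swap (u : Perm (Fin n)) (i j : Fin n) :
    vec (u * swap i j) = vec u +
      (((j : ℕ) : ℝ) - ((i : ℕ) : ℝ)) • (Pi.single (u i) 1 - Pi.single (u j) 1 : Fin n → ℝ) := by
  funext k
  obtain ⟨p, rfl⟩ := u.surjective k
  by_cases hi : p = i
  · subst hi
    by_cases hj : p = j
    · subst hj; simp [vec]
    · simp [vec, hj]; ring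
  · by_cases hj : p = j
    · subst hj
      simp [vec, hi]; ring
    · simp [vec, hi, hj, swap_apply_of_ne_of_ne hi hj]

theorem sum_mul_vec_mul_swap (f : Fin n → ℝ) (u : Perm (Fin n)) (i j : Fin n) :
    ∑ k, f k * vec (u * swap i j) k = ∑ k, f k * vec u k +
      (((j : ℕ) : ℝ) - ((i : ℕ) : ℝ)) * (f (u i) - f (u j)) := by
  rw [vec_mul_swap]
  simp only [Pi.add_apply, Pi.smul_apply, Pi.sub_apply, smul_eq_mul, mul_add,
    Finset.sum_add_distrib]
  congr 1
  rw [← sub_eq_zero]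
  simp only [mul_left_comm (f _), ← Finset.mul_sum]
  simp [mul_sub, Finset.sum_sub_distrib, Pi.single_apply]

theorem Arc.swap_mul {w u : Perm (Fin n)} {a b : Fin n} (h : Arc w u a b) :
    BruhatLE (swap a b * u) w := by
  obtain ⟨i, j, -, rfl, rfl, h⟩ := h
  rwa [← mul_swap_eq]

theorem Arc.flip {w u : Perm (Fin n)} {a b : Fin n} (hu : BruhatLE u w) (h : Arc w u a b) :
    Arc w (swap a b * u) b a := by
  obtain ⟨i, j, hij, rfl, rfl, h⟩ := h
  exact ⟨i, j, hij, by simp, by simp, by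
    rwa [← mul_swap_eq, mul_assoc, swap_mul_self, mul_one]⟩

/-- A functional that is monotone on the arcs at `u` and takes the same value at `a` and `b` is
monotone on the arcs at `(a b) u`. -/
theorem monotone_swap_mul {w u : Perm (Fin n)} (hu : BruhatLE u w) {f : Fin n → ℝ} {a b : Fin n}
    (hf : ∀ x y, Arc w u x y → f x ≤ f y) (hab : f a = f b) {x y : Fin n}
    (hxy : Arc w (swap a b * u) x y) : f x ≤ f y := by
  obtain ⟨i, j, hij, rfl, rfl, h⟩ := hxy
  -- Since f a = f b, the value at u equals the value at (a b)u, so no neighbour of (a b)u exceeds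
  -- the latter.
  have h1 := sum_mul_vec_le hu hf h
  rw [sum_mul_vec_mul_swap, swap_left_mul, sum_mul_vec_mul_swap] at h1
  simp only [Perm.inv_def, apply_symm_apply, hab, sub_self, mul_zero, add_zero] at h1
  rw [swap_left_mul]
  have h2 : ((i : ℕ) : ℝ) < ((j : ℕ) : ℝ) := by exact_mod_cast hij
  simp only [Perm.inv_def] at h1 ⊢
  nlinarith

/-- The indicator of the set above x in the contraction is monotone on the arcs at u and equal at a
and b, hence monotone on the arcs at (a b)u; being 1 at x, it is 1 at y. -/
theorem contract_of_arc {w u : Perm (Fin n)} (hu : BruhatLE u w) {a b : Fin n}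
    (hab : Arc w u a b) {x y : Fin n} (hxy : Arc w (swap a b * u) x y) :
    Contract (Arc w u) a b x y := by
  classical
  have h := monotone_swap_mul hu (a := a) (b := b)
    (f := fun z => if Contract (Arc w u) a b x z then (1 : ℝ) else 0) ?_ ?_ hxy
  · by_contra hcon
    have h0 : Contract (Arc w u) a b x x := Or.inl .refl
    rw [if_pos h0, if_neg hcon] at h
    norm_num at h
  · intro p q hpq
    split_ifs with h1 h2
    · exact le_rfl
    · exact (h2 (h1.trans (Or.inl (.single hpq)))).elim
    · exact zero_le_one
    · exact le_rfl
  · have : Contract (Arc w u) a b x a ↔ Contract (Arc w u) a b x b :=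
      ⟨fun h1 => h1.trans (Or.inl (.single hab)), fun h1 => h1.trans (Or.inr ⟨.refl, .refl⟩)⟩
    simp only [this]

theorem arcFlip {w u : Perm (Fin n)} (hu : BruhatLE u w) {a b : Fin n}
    (hab : IsCov (Arc w u) a b) (hlt : a < b) :
    ArcFlip (posZ u) (posZ (swap a b * u)) valZ (Arc w u) (Arc w (swap a b * u)) a b where
  left := arcSystem hu
  right := arcSystem hab.1.swap_mul
  pos_a := by simp [posZ]
  pos_b := by simp [posZ]
  pos_ne x h1 h2 := by simp [posZ, swap_apply_of_ne_of_ne h1 h2]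
  cov := hab
  val_lt := valZ_lt.2 hlt
  right_le x y hxy := contract_of_arc hu hab.1 hxy
  left_le x y hxy := by
    refine contract_of_arc hab.1.swap_mul (hab.1.flip hu) ?_
    rwa [swap_comm b a, swap_mul_swap_mul]

/-! ### Corresponding arcs -/

theorem Corresponds.eq_or_eq {w u : Perm (Fin n)} (hu : BruhatLE u w) {a b : Fin n}
    (hab : IsCov (Arc w u) a b) (hlt : a < b) {c d : Fin n} (hcd : IsCov (Arc w u) c d)
    {e : Fin n × Fin n} (he : IsCov (Arc w (swap a b * u)) e.1 e.2)
    (h : Corresponds (swap a b) c d e) : e = (c, d) ∨ e = (swap a b c, swap a b d) := by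
  obtain ⟨h1, h2⟩ := (arcFlip hu hab hlt).not_cov_reverse hcd
  rcases h with (rfl | rfl) | (rfl | rfl)
  · exact Or.inl rfl
  · by_cases hc : c = a ∧ d = b
    · obtain ⟨rfl, rfl⟩ := hc
      right; simp
    · exact (h1 ⟨by tauto, he⟩).elim
  · exact Or.inr rfl
  · exact (h2 he).elim

theorem corresponds_symm {t : Perm (Fin n)} {c d : Fin n} {e : Fin n × Fin n}
    (h : Corresponds t c d e) : Corresponds t d c e :=
  Or.imp Or.symm Or.symm h

theorem existsUnique_corresponds {w u : Perm (Fin n)} (hu : BruhatLE u w) {a b : Fin n}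
    (hab : IsCov (Arc w u) a b) (hlt : a < b) {c d : Fin n} (hcd : IsCov (Arc w u) c d) :
    ∃! e : Fin n × Fin n, e ∈ E w (swap a b * u) ∧ Corresponds (swap a b) c d e := by
  have hflip := arcFlip hu hab hlt
  have hv := hab.1.swap_mul
  have huniq : ∀ e e' : Fin n × Fin n, e ∈ E w (swap a b * u) → e' ∈ E w (swap a b * u) →
      Corresponds (swap a b) c d e → Corresponds (swap a b) c d e' → e = e' := by
    intro e e' he he' h h'
    rw [mem_E_iff hv] at he he'
    have key : IsCov (Arc w (swap a b * u)) c d →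
        IsCov (Arc w (swap a b * u)) (swap a b c) (swap a b d) →
        (swap a b c, swap a b d) = (c, d) := by
      intro h1 h2
      have := (arcSystem hv).swap_eq_of_cov hflip.cov_right h1 (by rwa [swap_comm b a])
      rwa [swap_comm b a] at this
    rcases h.eq_or_eq hu hab hlt hcd he with rfl | rfl <;>
      rcases h'.eq_or_eq hu hab hlt hcd he' with rfl | rfl
    · rfl
    · exact (key he he').symm
    · exact key he' he
    · rfl
  obtain ⟨e, he⟩ : ∃ e : Fin n × Fin n, e ∈ E w (swap a b * u) ∧ Corresponds (swap a b) c d e := by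
    rcases hflip.exists_cov hcd with h | h
    · exact ⟨(c, d), (mem_E_iff hv).2 h, Or.inl (Or.inl rfl)⟩
    · exact ⟨_, (mem_E_iff hv).2 h, Or.inr (Or.inl rfl)⟩
  exact ⟨e, he, fun e' he' => huniq e' e he'.1 he.1 he'.2 he.2⟩

theorem exists_injective_corresponds {w u : Perm (Fin n)} (hu : BruhatLE u w) {a b : Fin n}
    (hab : IsCov (Arc w u) a b) (hlt : a < b) :
    ∃ φ : E w u → E w (swap a b * u),
      (∀ e : E w u, Corresponds (swap a b) e.1.1 e.1.2 (φ e).1) ∧ Function.Injective φ := by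
  have hv := hab.1.swap_mul
  have hex : ∀ e : E w u, ∃ e' : E w (swap a b * u),
      Corresponds (swap a b) e.1.1 e.1.2 e'.1 := by
    rintro ⟨e, he⟩
    obtain ⟨e', ⟨h1, h2⟩, -⟩ := existsUnique_corresponds hu hab hlt ((mem_E_iff hu).1 he)
    exact ⟨⟨e', h1⟩, h2⟩
  choose φ hφ using hex
  refine ⟨φ, hφ, ?_⟩
  have key : ∀ e e' : Fin n × Fin n, IsCov (Arc w u) e.1 e.2 → IsCov (Arc w u) e'.1 e'.2 →
      e' = (swap a b e.1, swap a b e.2) → e = e' := by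
    rintro ⟨c, d⟩ _ h1 h2 rfl
    exact ((arcSystem hu).swap_eq_of_cov hab h1 h2).symm
  rintro ⟨e, he⟩ ⟨e', he'⟩ heq
  have h1 := (hφ ⟨e, he⟩).eq_or_eq hu hab hlt ((mem_E_iff hu).1 he)
    ((mem_E_iff hv).1 (φ ⟨e, he⟩).2)
  have h2 := (hφ ⟨e', he'⟩).eq_or_eq hu hab hlt ((mem_E_iff hu).1 he')
    ((mem_E_iff hv).1 (φ ⟨e', he'⟩).2)
  rw [mem_E_iff hu] at he he'
  rw [heq] at h1
  refine Subtype.ext ?_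
  dsimp only at h1 h2 ⊢
  rcases h1 with h1 | h1 <;> rcases h2 with h2 | h2
  · exact h1.symm.trans h2
  · exact (key e' e he' he (h1.symm.trans h2)).symm
  · exact key e e' he he' (h2.symm.trans h1)
  · have h3 := h1.symm.trans h2
    rw [Prod.mk.injEq] at h3
    exact Prod.ext ((swap a b).injective h3.1) ((swap a b).injective h3.2)

/-! ### Edges of the polytope -/

/-- The linear functional with the given coefficients. -/
noncomputable def dot (f : Fin n → ℝ) : (Fin n → ℝ) →L[ℝ] ℝ :=
  ∑ k, f k • ContinuousLinearMap.proj k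

theorem dot_apply (f z : Fin n → ℝ) : dot f z = ∑ k, f k * z k := by
  simp [dot]

theorem eq_dot (l : (Fin n → ℝ) →L[ℝ] ℝ) : l = dot fun k => l (Pi.single k 1) := by
  refine ContinuousLinearMap.ext fun z => ?_
  rw [dot_apply]
  have := LinearMap.pi_apply_eq_sum_univ (l : (Fin n → ℝ) →ₗ[ℝ] ℝ) z
  simp only [ContinuousLinearMap.coe_coe, smul_eq_mul] at this
  rw [this]
  refine Finset.sum_congr rfl fun k _ => ?_
  rw [mul_comm]
  congr 2
  funext i
  simp [Pi.single_apply, eq_comm]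

theorem vec_mem_Q {w u : Perm (Fin n)} (hu : BruhatLE u w) : vec u ∈ Q w :=
  subset_convexHull ℝ _ ⟨u, hu, rfl⟩

theorem vec_injective : Function.Injective (vec : Perm (Fin n) → Fin n → ℝ) := by
  intro u v h
  have : u⁻¹ = v⁻¹ := Equiv.ext fun i => Fin.ext (by
    have := congrFun h i
    simpa [vec] using this)
  exact inv_injective this

theorem dot_le_of_monotone {w u : Perm (Fin n)} (hu : BruhatLE u w) {f : Fin n → ℝ}
    (hf : ∀ a b, Arc w u a b → f a ≤ f b) {z : Fin n → ℝ} (hz : z ∈ Q w) :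
    dot f z ≤ dot f (vec u) := by
  refine convexHull_min (t := {z | dot f z ≤ dot f (vec u)}) ?_
    (convex_halfSpace_le (dot f).toLinearMap.isLinear _) hz
  rintro _ ⟨v, hv, rfl⟩
  rw [Set.mem_ofPred_eq, dot_apply, dot_apply]
  exact sum_mul_vec_le hu hf hv

theorem dot_vec_swap_mul (f : Fin n → ℝ) (u : Perm (Fin n)) (a b : Fin n) :
    dot f (vec (swap a b * u)) = dot f (vec u) +
      ((((u⁻¹ b : Fin n) : ℕ) : ℝ) - (((u⁻¹ a : Fin n) : ℕ) : ℝ)) * (f a - f b) := by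
  rw [dot_apply, dot_apply, swap_left_mul, sum_mul_vec_mul_swap]
  simp

theorem Arc.pos_lt {w u : Perm (Fin n)} {a b : Fin n} (h : Arc w u a b) :
    (((u⁻¹ a : Fin n) : ℕ) : ℝ) < (((u⁻¹ b : Fin n) : ℕ) : ℝ) := by
  obtain ⟨i, j, hij, rfl, rfl, -⟩ := h
  simpa using hij

theorem le_of_dot_max {w u : Perm (Fin n)} {f : Fin n → ℝ}
    (hf : ∀ z ∈ Q w, dot f z ≤ dot f (vec u)) {a b : Fin n} (hab : Arc w u a b) : f a ≤ f b := by
  have h1 := hf _ (vec_mem_Q hab.swap_mul)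
  rw [dot_vec_swap_mul] at h1
  have := hab.pos_lt
  nlinarith

/-- On the face where a functional `f` is maximal, functionals that agree on the arcs on which `f`
is constant are maximal at `u` as well. -/
theorem dot_le_of_face {w u : Perm (Fin n)} (hu : BruhatLE u w) {f g : Fin n → ℝ}
    (hfg : ∀ a b, Arc w u a b → f a < f b ∨ (f a = f b ∧ g a = g b)) {z : Fin n → ℝ}
    (hz : z ∈ Q w) (hfz : dot f (vec u) ≤ dot f z) : dot g z ≤ dot g (vec u) := by
  -- There are finitely many arcs, so f + εg is still monotone along them for small ε > 0.
  have hev : ∀ᶠ ε : ℝ in nhdsWithin 0 (Set.Ioi 0), ∀ a b, Arc w u a b →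
      f a + ε * g a ≤ f b + ε * g b := by
    refine Filter.eventually_all.2 fun a => Filter.eventually_all.2 fun b => ?_
    by_cases hab : Arc w u a b
    · rcases hfg a b hab with h | ⟨h, h'⟩
      · have h1 : Filter.Tendsto (fun ε : ℝ => f a + ε * g a) (nhdsWithin 0 (Set.Ioi 0))
            (nhds (f a)) := by
          have : Continuous fun ε : ℝ => f a + ε * g a := by fun_prop
          simpa using (this.tendsto 0).mono_left nhdsWithin_le_nhds
        have h2 : Filter.Tendsto (fun ε : ℝ => f b + ε * g b) (nhdsWithin 0 (Set.Ioi 0))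
            (nhds (f b)) := by
          have : Continuous fun ε : ℝ => f b + ε * g b := by fun_prop
          simpa using (this.tendsto 0).mono_left nhdsWithin_le_nhds
        filter_upwards [h1.eventually_lt h2 h] with ε hε _ using hε.le
      · exact Filter.Eventually.of_forall fun ε _ => by rw [h, h']
    · exact Filter.Eventually.of_forall fun ε h => (hab h).elim
  obtain ⟨ε, hε, hε0⟩ := (hev.and self_mem_nhdsWithin).exists
  have h1 := dot_le_of_monotone hu (f := fun k => f k + ε * g k) hε hz
  have h2 : ∀ z, dot (fun k => f k + ε * g k) z = dot f z + ε * dot g z := by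
    intro z
    simp only [dot_apply, add_mul, Finset.sum_add_distrib, Finset.mul_sum, mul_assoc]
  rw [h2, h2] at h1
  have h3 : ε * dot g z ≤ ε * dot g (vec u) := by linarith
  exact le_of_mul_le_mul_left h3 hε0

/-- The indicator of the set above b is maximal at u, vanishes at a and is 1 at b, so it decreases
strictly from u towards (a b)u. -/
theorem coeff_nonneg {w u : Perm (Fin n)} (hu : BruhatLE u w) {a b : Fin n} (hab : Arc w u a b)
    {c : ℝ} (hz : vec u + c • (vec (swap a b * u) - vec u) ∈ Q w) : 0 ≤ c := by
  classical
  have h := dot_le_of_monotone hu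
    (f := fun y => if ReflTransGen (Arc w u) b y then (1 : ℝ) else 0) ?_ hz
  · rw [map_add, map_smul, map_sub, dot_vec_swap_mul] at h
    have hba : ¬ ReflTransGen (Arc w u) b a := fun h1 => by
      have h2 := (arcSystem hu).pos_le h1
      have h3 := (arcSystem hu).pos_lt hab
      omega
    have hbb : ReflTransGen (Arc w u) b b := .refl
    rw [if_neg hba, if_pos hbb] at h
    have := hab.pos_lt
    simp only [smul_eq_mul] at h
    by_contra hc
    push Not at hc
    nlinarith
  · intro p q hpq
    split_ifs with h1 h2
    · exact le_rfl
    · exact (h2 (h1.tail hpq)).elim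
    · exact zero_le_one
    · exact le_rfl

theorem mem_segment_of_arc {w u : Perm (Fin n)} (hu : BruhatLE u w) {a b : Fin n}
    (hab : Arc w u a b) {c : ℝ} (hz : vec u + c • (vec (swap a b * u) - vec u) ∈ Q w) :
    vec u + c • (vec (swap a b * u) - vec u) ∈ segment ℝ (vec u) (vec (swap a b * u)) := by
  have h0 := coeff_nonneg hu hab hz
  have h1 : 0 ≤ 1 - c := by
    refine coeff_nonneg hab.swap_mul (hab.flip hu) ?_
    rw [swap_comm b a, swap_mul_swap_mul]
    convert hz using 1
    module
  rw [segment_eq_image']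
  exact ⟨c, ⟨h0, by linarith⟩, rfl⟩

theorem vec_swap_mul_ne {u : Perm (Fin n)} {a b : Fin n} (hab : a ≠ b) :
    vec (swap a b * u) ≠ vec u := fun h => by
  have h1 := vec_injective h
  rw [mul_eq_right, swap_eq_one_iff] at h1
  exact hab h1

theorem Arc.ne {w u : Perm (Fin n)} {a b : Fin n} (h : Arc w u a b) : a ≠ b := by
  rintro rfl; exact lt_irrefl _ h.pos_lt

/-- A functional whose maximal face is the segment attached to an arc of the reduction. -/
theorem exists_functional {w u : Perm (Fin n)} (hu : BruhatLE u w) {a b : Fin n}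
    (hab : IsCov (Arc w u) a b) : ∃ f : Fin n → ℝ, f a = f b ∧
      ∀ x y, Arc w u x y → f x < f y ∨ (x = a ∧ y = b) := by
  classical
  -- Counting the elements below y in the contraction gives a function that agrees at a and b and
  -- increases strictly along every other arc.
  let s : Fin n → Finset (Fin n) := fun y =>
    Finset.univ.filter fun x => Contract (Arc w u) a b x y
  have hs : ∀ x y, x ∈ s y ↔ Contract (Arc w u) a b x y := fun x y => by simp [s]
  have hmono : ∀ x y, Contract (Arc w u) a b x y → s x ⊆ s y := fun x y h z hz =>
    (hs z y).2 (((hs z x).1 hz).trans h)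
  refine ⟨fun y => (s y).card, ?_, fun x y hxy => ?_⟩
  · have : s a = s b := (hmono _ _ (Or.inl (.single hab.1))).antisymm
      (hmono _ _ (Or.inr ⟨.refl, .refl⟩))
    simp only [this]
  · by_cases hyx : Contract (Arc w u) a b y x
    · right
      have hp := (arcSystem hu).pos_lt hxy
      have hp' := (arcSystem hu).pos_lt hab.1
      rcases hyx with h | ⟨h1, h2⟩
      · have := (arcSystem hu).pos_le h
        omega
      · have e1 := hab.eq_or_eq h2 (ReflTransGen.head hxy h1)
        have e2 := hab.eq_or_eq (h2.tail hxy) h1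
        rcases e1 with rfl | rfl <;> rcases e2 with rfl | rfl
        all_goals first | exact ⟨rfl, rfl⟩ | omega
    · left
      have : s x ⊂ s y := by
        refine (Finset.ssubset_iff_of_subset (hmono _ _ (Or.inl (.single hxy)))).2 ⟨y, ?_, ?_⟩
        · exact (hs y y).2 (Or.inl .refl)
        · exact fun h => hyx ((hs y x).1 h)
      exact Nat.cast_lt.2 (Finset.card_lt_card this)

theorem dot_single (k : Fin n) (c : ℝ) (z : Fin n → ℝ) : dot (Pi.single k c) z = c * z k := by
  simp [dot_apply, Pi.single_apply]

theorem dot_neg (f z : Fin n → ℝ) : dot (-f) z = - dot f z := by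
  simp [dot_apply]

theorem isEdge_of_cov {w u : Perm (Fin n)} (hu : BruhatLE u w) {a b : Fin n}
    (hab : IsCov (Arc w u) a b) :
    IsEdge (Q w) (segment ℝ (vec u) (vec (swap a b * u))) := by
  have hne := hab.1.ne
  refine ⟨fun _ => ?_, ?_⟩
  · obtain ⟨f, hfab, hf⟩ := exists_functional hu hab
    have hmono : ∀ x y, Arc w u x y → f x ≤ f y := by
      intro x y hxy
      rcases hf x y hxy with h | ⟨rfl, rfl⟩
      · exact h.le
      · exact hfab.le
    have hmax : ∀ z ∈ Q w, dot f z ≤ dot f (vec u) := fun z hz => dot_le_of_monotone hu hmono hz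
    refine ⟨dot f, Set.Subset.antisymm ?_ ?_⟩
    · intro z hz
      refine ⟨(convex_convexHull ℝ _).segment_subset (vec_mem_Q hu) (vec_mem_Q hab.1.swap_mul) hz,
        fun y hy => (hmax y hy).trans (le_of_eq ?_)⟩
      rw [segment_eq_image'] at hz
      obtain ⟨c, -, rfl⟩ := hz
      simp only
      rw [map_add, map_smul, map_sub, dot_vec_swap_mul, hfab]
      simp
    · rintro z ⟨hz, hzmax⟩
      -- Applied to g and -g, `dot_le_of_face` shows that each g with g a = g b is constant on the
      -- face, which confines the face to a line.
      have hface : ∀ g : Fin n → ℝ, g a = g b → dot g z = dot g (vec u) := by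
        intro g hg
        have key : ∀ g : Fin n → ℝ, g a = g b → dot g z ≤ dot g (vec u) := fun g hg =>
          dot_le_of_face hu (f := f) (fun x y hxy => (hf x y hxy).imp id fun h => by
            rw [h.1, h.2]; exact ⟨hfab, hg⟩) hz (hzmax _ (vec_mem_Q hu))
        refine le_antisymm (key g hg) ?_
        have := key (-g) (by simp [hg])
        rw [dot_neg, dot_neg] at this
        linarith
      have hzk : ∀ k, k ≠ a → k ≠ b → z k = vec u k := by
        intro k hka hkb
        have := hface (Pi.single k 1) (by simp [hka.symm, hkb.symm])
        simpa [dot_single] using this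
      have hzab : z a + z b = vec u a + vec u b := by
        have := hface (Pi.single a 1 + Pi.single b 1) (by simp [hne, hne.symm])
        simpa [dot_apply, add_mul, Finset.sum_add_distrib, Pi.single_apply] using this
      have hpos := hab.1.pos_lt
      set δ : ℝ := (((u⁻¹ b : Fin n) : ℕ) : ℝ) - (((u⁻¹ a : Fin n) : ℕ) : ℝ) with hδ
      have hδ0 : δ ≠ 0 := (sub_pos.2 hpos).ne'
      have hzeq : z = vec u + ((z a - vec u a) / δ) • (vec (swap a b * u) - vec u) := by
        rw [swap_left_mul, vec_mul_swap, ← hδ, add_sub_cancel_left, smul_smul,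
          div_mul_cancel₀ _ hδ0]
        funext k
        by_cases hka : k = a
        · subst hka; simp [hne]
        · by_cases hkb : k = b
          · subst hkb
            simp [hka]
            linarith
          · simp [hka, hkb, hzk k hka hkb]
      rw [hzeq] at hz ⊢
      exact mem_segment_of_arc hu hab.1 hz
  · rw [vectorSpan_segment]
    exact finrank_span_singleton (sub_ne_zero.2 (vec_swap_mul_ne hne))

/-- If the tight arc is refined by a path, monotonicity of f makes the first arc of that path tight
too, and it spans a smaller distance. -/
theorem exists_cov_of_tight {w u : Perm (Fin n)} (hu : BruhatLE u w) {f : Fin n → ℝ}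
    (hf : ∀ x y, Arc w u x y → f x ≤ f y) (m : ℕ) :
    ∀ x y, (posZ u y - posZ u x).toNat ≤ m → Arc w u x y → f x = f y →
      ∃ a b, IsCov (Arc w u) a b ∧ f a = f b := by
  have hs := arcSystem hu
  have hf' : ∀ x y, ReflTransGen (Arc w u) x y → f x ≤ f y := by
    intro x y h
    induction h with
    | refl => exact le_rfl
    | tail _ h ih => exact ih.trans (hf _ _ h)
  induction m with
  | zero => intro x y h hxy; have := hs.pos_lt hxy; omega
  | succ m ih =>
    intro x y hm hxy hfxy
    by_cases hcov : IsCov (Arc w u) x y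
    · exact ⟨x, y, hcov, hfxy⟩
    · have : ∃ c, TransGen (Arc w u) x c ∧ TransGen (Arc w u) c y := by
        by_contra h; exact hcov ⟨hxy, h⟩
      obtain ⟨c, h1, h2⟩ := this
      obtain ⟨p, h3, h4⟩ := TransGen.head'_iff.1 h1
      have e1 := hs.pos_le h4
      have e2 := hs.pos_lt_of_transGen h2
      have e3 := hs.pos_lt h3
      refine ih x p (by omega) h3 (le_antisymm (hf _ _ h3) ?_)
      exact (hf' _ _ h4).trans ((hf' _ _ h2.to_reflTransGen).trans hfxy.ge)

/-- If f were strict on every arc, the face would be the single vertex u. So some covering arc is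
tight; its segment lies in F, and F, being one-dimensional, lies on the line of that segment. -/
theorem exists_cov_of_isEdge {w u : Perm (Fin n)} (hu : BruhatLE u w) {F : Set (Fin n → ℝ)}
    (hF : IsEdge (Q w) F) (huF : vec u ∈ F) :
    ∃ a b, IsCov (Arc w u) a b ∧ F = segment ℝ (vec u) (vec (swap a b * u)) := by
  obtain ⟨hexp, hrank⟩ := hF
  obtain ⟨l, hl⟩ := hexp ⟨_, huF⟩
  obtain ⟨f, rfl⟩ : ∃ f, l = dot f := ⟨_, eq_dot l⟩
  have hmemF : ∀ z, z ∈ F ↔ z ∈ Q w ∧ ∀ y ∈ Q w, dot f y ≤ dot f z := fun z => by rw [hl]; rfl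
  have hmax := ((hmemF _).1 huF).2
  have hmono : ∀ x y, Arc w u x y → f x ≤ f y := fun x y hxy => le_of_dot_max hmax hxy
  obtain ⟨a, b, hab, hfab⟩ : ∃ a b, IsCov (Arc w u) a b ∧ f a = f b := by
    by_contra hcon
    have hstrict : ∀ x y, Arc w u x y → f x < f y := by
      intro x y hxy
      refine lt_of_le_of_ne (hmono x y hxy) fun e => hcon ?_
      exact exists_cov_of_tight hu hmono _ x y le_rfl hxy e
    have hsingle : F = {vec u} := by
      refine Set.eq_singleton_iff_unique_mem.2 ⟨huF, fun z hz => ?_⟩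
      obtain ⟨hzQ, hzmax⟩ := (hmemF z).1 hz
      have key : ∀ g : Fin n → ℝ, dot g z ≤ dot g (vec u) := fun g =>
        dot_le_of_face hu (fun x y hxy => Or.inl (hstrict x y hxy)) hzQ (hzmax _ (vec_mem_Q hu))
      funext k
      have h1 := key (Pi.single k 1)
      have h2 := key (Pi.single k (-1))
      rw [dot_single, dot_single] at h1 h2
      linarith
    rw [hsingle, vectorSpan_singleton, finrank_bot] at hrank
    exact zero_ne_one hrank
  refine ⟨a, b, hab, ?_⟩
  have hvF : ∀ c : ℝ, dot f (vec u + c • (vec (swap a b * u) - vec u)) = dot f (vec u) := by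
    intro c
    rw [map_add, map_smul, map_sub, dot_vec_swap_mul, hfab]
    simp
  have hsub : segment ℝ (vec u) (vec (swap a b * u)) ⊆ F := by
    intro z hz
    refine (hmemF z).2 ⟨(convex_convexHull ℝ _).segment_subset (vec_mem_Q hu)
      (vec_mem_Q hab.1.swap_mul) hz, fun y hy => ?_⟩
    rw [segment_eq_image'] at hz
    obtain ⟨c, -, rfl⟩ := hz
    exact (hmax y hy).trans (hvF c).ge
  refine Set.Subset.antisymm (fun z hz => ?_) hsub
  have hv0 : vec (swap a b * u) - vec u ∈ vectorSpan ℝ F :=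
    vsub_mem_vectorSpan ℝ (hsub (right_mem_segment ℝ _ _)) huF
  have hz0 : z - vec u ∈ vectorSpan ℝ F := vsub_mem_vectorSpan ℝ hz huF
  have hne : (⟨_, hv0⟩ : vectorSpan ℝ F) ≠ 0 := fun h =>
    sub_ne_zero.2 (vec_swap_mul_ne hab.1.ne) (congrArg Subtype.val h)
  obtain ⟨c, hc⟩ := (finrank_eq_one_iff_of_nonzero' _ hne).1 hrank ⟨_, hz0⟩
  have hc' : c • (vec (swap a b * u) - vec u) = z - vec u := congrArg Subtype.val hc
  have hzeq : z = vec u + c • (vec (swap a b * u) - vec u) := by rw [hc']; abel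
  have hzQ := ((hmemF z).1 hz).1
  rw [hzeq] at hzQ ⊢
  exact mem_segment_of_arc hu hab.1 hzQ

theorem eq_of_segment_eq {x y z : Fin n → ℝ} (h : segment ℝ x y = segment ℝ x z) : y = z := by
  have h1 : y ∈ segment ℝ x z := h ▸ right_mem_segment ℝ x y
  have h2 : z ∈ segment ℝ x y := h ▸ right_mem_segment ℝ x z
  rw [segment_eq_image'] at h1 h2
  obtain ⟨c, ⟨hc0, hc1⟩, hc⟩ := h1
  obtain ⟨d, ⟨hd0, hd1⟩, hd⟩ := h2
  funext k
  have e1 := congrFun hc k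
  have e2 := congrFun hd k
  simp only [Pi.add_apply, Pi.smul_apply, Pi.sub_apply, smul_eq_mul] at e1 e2
  have e3 : (1 - c) * (z k - x k) = (z k - y k) := by linarith
  have e4 : (1 - d) * (y k - x k) = (y k - z k) := by linarith
  have hp : (y k - x k) * (z k - x k) = c * (z k - x k) ^ 2 := by rw [← e1]; ring
  have hq : (y k - x k) * (z k - x k) = d * (y k - x k) ^ 2 := by rw [← e2]; ring
  nlinarith [sq_nonneg (y k - z k), sq_nonneg (z k - x k), sq_nonneg (y k - x k),
    mul_nonneg (sub_nonneg.2 hc1) (sq_nonneg (z k - x k)),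
    mul_nonneg (sub_nonneg.2 hd1) (sq_nonneg (y k - x k))]

theorem deg_eq_encard_E {w u : Perm (Fin n)} (hu : BruhatLE u w) :
    deg w u = (E w u).encard := by
  have himage : {F | IsEdge (Q w) F ∧ vec u ∈ F} =
      (fun e : Fin n × Fin n => segment ℝ (vec u) (vec (swap e.1 e.2 * u))) '' E w u := by
    ext F
    constructor
    · rintro ⟨hF, huF⟩
      obtain ⟨a, b, hab, rfl⟩ := exists_cov_of_isEdge hu hF huF
      exact ⟨(a, b), (mem_E_iff hu).2 hab, rfl⟩
    · rintro ⟨e, he, rfl⟩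
      exact ⟨isEdge_of_cov hu ((mem_E_iff hu).1 he), left_mem_segment ℝ _ _⟩
  rw [deg, himage]
  refine Set.InjOn.encard_image ?_
  rintro ⟨a, b⟩ he ⟨c, d⟩ he' h
  rw [mem_E_iff hu] at he he'
  have h1 := mul_right_cancel (vec_injective (eq_of_segment_eq h))
  have hp := he.1.pos_lt
  have hp' := he'.1.pos_lt
  dsimp only at h1 hp hp' ⊢
  have hb : swap c d a = b := by rw [← h1, swap_apply_left]
  by_cases hac : a = c
  · subst hac
    rw [swap_apply_left] at hb
    rw [hb]
  by_cases had : a = d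
  · subst had
    rw [swap_apply_right] at hb
    rw [hb] at hp'
    exact (lt_asymm hp hp').elim
  rw [swap_apply_of_ne_of_ne hac had] at hb
  exact (he.1.ne hb).elim

/-- The cover relation of the one-skeleton poset in terms of arcs. -/
theorem SkeletonCover.exists_cov {w : Perm (Fin n)} {u v : Interval w} (h : SkeletonCover w u v) :
    ∃ a b, a < b ∧ IsCov (Arc w u.1) a b ∧ v.1 = swap a b * u.1 := by
  obtain ⟨a, b, hab, hseg⟩ := exists_cov_of_isEdge u.2 h.1 (left_mem_segment ℝ _ _)
  have hv : v.1 = swap a b * u.1 := vec_injective (eq_of_segment_eq hseg)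
  refine ⟨a, b, ?_, hab, hv⟩
  have hl := h.2
  rw [hv, length_eq_inv, length_eq_inv] at hl
  obtain ⟨i, j, hij, rfl, rfl, -⟩ := hab.1
  rw [← mul_swap_eq] at hl
  by_contra hcon
  have hlt : u.1 j < u.1 i := lt_of_le_of_ne (not_lt.1 hcon) fun e =>
    hij.ne' (u.1.injective e)
  have := inv_lt_mul_swap (u := u.1 * swap i j) hij (by simpa using hlt)
  rw [mul_assoc, swap_mul_self, mul_one] at this
  omega

theorem SkeletonCover.deg_le {w : Perm (Fin n)} {u v : Interval w} (h : SkeletonCover w u v) :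
    deg w u.1 ≤ deg w v.1 := by
  obtain ⟨a, b, hlt, hab, hv⟩ := h.exists_cov
  obtain ⟨φ, -, hφ⟩ := exists_injective_corresponds u.2 hab hlt
  rw [deg_eq_encard_E u.2, deg_eq_encard_E v.2, hv]
  exact Function.Embedding.encard_le ⟨φ, hφ⟩

end BruhatPolytope

open BruhatPolytope in
theorem theorem5p1 {n : ℕ} (w : Equiv.Perm (Fin n)) :
    (∀ u v : Interval w, SkeletonLE w u v → deg w u.1 ≤ deg w v.1) ∧
    (∀ u v : Interval w, SkeletonCover w u v →
      ∃ t : Equiv.Perm (Fin n), t.IsSwap ∧ v.1 = t * u.1 ∧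
        (∀ c d : Fin n, ((c, d) ∈ E w u.1 ∨ (d, c) ∈ E w u.1) →
          ∃! e : Fin n × Fin n, e ∈ E w v.1 ∧ Corresponds t c d e) ∧
        (∃ φ : E w u.1 → E w v.1,
          (∀ e : E w u.1, Corresponds t e.1.1 e.1.2 (φ e).1) ∧
          Function.Injective φ)) := by
  refine ⟨fun u v h => ?_, fun u v h => ?_⟩
  · induction h with
    | refl => exact le_rfl
    | tail _ h ih => exact ih.trans h.deg_le
  · obtain ⟨a, b, hlt, hab, hv⟩ := h.exists_cov
    refine ⟨Equiv.swap a b, ⟨a, b, hlt.ne, rfl⟩, hv, ?_, ?_⟩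
    · intro c d hcd
      rw [hv]
      rcases hcd with hcd | hcd
      · exact existsUnique_corresponds u.2 hab hlt ((mem_E_iff u.2).1 hcd)
      · obtain ⟨e, ⟨h1, h2⟩, h3⟩ :=
          existsUnique_corresponds u.2 hab hlt ((mem_E_iff u.2).1 hcd)
        exact ⟨e, ⟨h1, corresponds_symm h2⟩, fun e' he' => h3 e' ⟨he'.1, corresponds_symm he'.2⟩⟩
    · rw [hv]
      exact exists_injective_corresponds u.2 hab hlt
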